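/- Let $(\Omega,\mathcal F,\mathbb P)$ be a probability space with a filtration $(\mathcal F_i)_{i\ge 0}$, and let $(X_i,\mathcal F_i)_{i\ge 0}$ be a supermartingale difference sequence, i.e. each $X_i$ is a real integrable $\mathcal F_i$-measurable random variable and $\mathbb E[X_i\mid\mathcal F_{i-1}]\le 0$ almost surely for all $i\ge 1$. For every $i\ge1$ let $B_i$ be a real $\mathcal F_{i-1}$-measurable random variable with $X_i\le B_i$ almost surely. Put $\sigma_i^2=\mathbb E[X_i^2\mid\mathcal F_{i-1}]\in[0,\infty]$, $$s_i=\frac12\Bigl(B_i+\frac{\sigma_i^2}{B_i}\Bigr),\qquad V_k^2=\sum_{i=1}^k s_i^2,$$ with the convention $\sigma_i^2/B_i=0$ where $B_i=0$. For $x\ge 0$ and $0<v<\infty$ let $$\mathcal E_k=\Bigl\{\sum_{i=1}^k X_i\ge x\ \text{ and }\ V_k^2\le v^2\Bigr\}.$$ Then, with $Z\sim N(0,1)$ and $u_+=\max(u,0)$, for every $n\ge1$ $$\mathbb P\Bigl(\bigcup_{k=1}^n\mathcal E_k\Bigr)\le\inf_{\lambda\ge0}\mathbb E\Bigl[\Bigl(1+\frac{\lambda}{5}(vZ-x)\Bigr)_+^5\Bigr]\le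 5!\,(e/5)^5\,\mathbb P(vZ\ge x).$$ Moreover, $$\mathbb P\Bigl(\sum_{i=1}^n X_i\ge x\ \text{ and }\ \sum_{i=1}^n s_i^2\le v^2\ \text{ for some } n\ge1\Bigr)\le\inf_{\lambda\ge0}\mathbb E\Bigl[\Bigl(1+\frac{\lambda}{5}(vZ-x)\Bigr)_+^5\Bigr].$$ -/

import Mathlib

open MeasureTheory ProbabilityTheory
open scoped ENNReal NNReal

noncomputable section

/-- `(X i, ℱ i)`, `i ≥ 0`, is a supermartingale difference sequence: `X i` is integrable and
`ℱ i`-measurable, and `E[X i | ℱ (i - 1)] ≤ 0` almost surely for `i ≥ 1`. -/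
def IsSupermartingaleDiff {Ω : Type*} {m : MeasurableSpace Ω} (X : ℕ → Ω → ℝ)
    (ℱ : Filtration ℕ m) (μ : Measure Ω) : Prop :=
  StronglyAdapted ℱ X ∧ (∀ i, Integrable (X i) μ) ∧
    ∀ i, 1 ≤ i → μ[X i | ℱ (i - 1)] ≤ᵐ[μ] 0

/-- The conditional second moment `σᵢ² = E[Xᵢ² | ℱᵢ₋₁]`, with values in `[0, ∞]` (the conditional
expectation of the nonnegative variable `Xᵢ²`, which need not be integrable). -/
def condSecondMoment {Ω : Type*} {m : MeasurableSpace Ω} (X : ℕ → Ω → ℝ)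
    (ℱ : Filtration ℕ m) (μ : Measure Ω) (i : ℕ) : Ω → ℝ≥0∞ :=
  condLExp (ℱ (i - 1)) μ (fun ω => ENNReal.ofReal (X i ω ^ 2))

/-- `sᵢ = (Bᵢ + σᵢ² / Bᵢ) / 2`, an extended real number. -/
def condScale {Ω : Type*} {m : MeasurableSpace Ω} (X B : ℕ → Ω → ℝ)
    (ℱ : Filtration ℕ m) (μ : Measure Ω) (i : ℕ) (ω : Ω) : EReal :=
  ((B i ω : EReal) + (condSecondMoment X ℱ μ i ω : EReal) / (B i ω : EReal)) / 2

/-- `Vₖ² = s₁² + ⋯ + sₖ²`. -/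
def cumScaleSq {Ω : Type*} {m : MeasurableSpace Ω} (X B : ℕ → Ω → ℝ)
    (ℱ : Filtration ℕ m) (μ : Measure Ω) (k : ℕ) (ω : Ω) : EReal :=
  ∑ i ∈ Finset.Icc 1 k, condScale X B ℱ μ i ω ^ 2

/-- The event `ℰₖ = {X₁ + ⋯ + Xₖ ≥ x and Vₖ² ≤ v²}`. -/
def crossingEvent {Ω : Type*} {m : MeasurableSpace Ω} (X B : ℕ → Ω → ℝ)
    (ℱ : Filtration ℕ m) (μ : Measure Ω) (x v : ℝ) (k : ℕ) : Set Ω :=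
  {ω | x ≤ ∑ i ∈ Finset.Icc 1 k, X i ω ∧ cumScaleSq X B ℱ μ k ω ≤ ((v ^ 2 : ℝ) : EReal)}

/-- `inf_{λ ≥ 0} E[(1 + (λ / 5) (v Z - x))₊ ^ 5]` with `Z` standard normal. -/
def gaussianBentkusBound (x v : ℝ) : ℝ :=
  ⨅ l : ℝ≥0, ∫ z, (max (1 + (l : ℝ) / 5 * (v * z - x)) 0) ^ 5 ∂(gaussianReal 0 1)

end

/-! Put `S k = X 1 + ⋯ + X k` and `f w = max w 0 ^ 5`. The proof replaces increments by normal
variables. Let `M k = E[f(1 + (λ/5)(S k - x + √(v² - V k²) Z))]` on `{V k² ≤ v²}` and `0` elsewhere,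
with `Z` independent of the past. `M 0` is the constant under the infimum. On a crossing event `M k
≥ 1`, by Jensen. So everything follows from Ville's inequality once `M` is a supermartingale.

Since `V (k+1)²` is known at time `k` and independent normal variables add, the supermartingale
property reduces to one variable: if `X ≤ b` with `b > 0`, mean `≤ 0` and second moment `σ²`, then
`E f(A + lX) ≤ E f(A + l s Z)` with `s = (b + σ²/b)/2`. (If `b ≤ 0` then `X ≤ 0` and Jensen
suffices.) A quadratic touching `f` at `-a`, `a = σ²/b`, and meeting it at `b` shows that the
extremal law is the mean-zero law on `{-a, b}` (`exists_quadratic_majorant`). Its half-width is `s`,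
so after scaling there remains an inequality in two real parameters, the mass `p` and the level `t`:
`two_point_le_gaussianPosPart`, the heart of the proof.

The comparison with the normal tail comes from log-concavity: the tail lies below its exponential
tangent at `x / v`, and a suitable `λ` turns the fifth-power bound into a Gamma integral
(`gaussianTail_le`, `gaussianPosPart_le`). -/

/-! ### Moments of the normal law on a half-line. -/

/-- `∫₀^∞ zⁿ exp (-z² / 2) dz`. -/
noncomputable def halfGaussianMoment (n : ℕ) : ℝ :=
  ∫ z in Set.Ioi (0 : ℝ), z ^ n * Real.exp (-(1 / 2) * z ^ 2)

lemma halfGaussianMoment_eq (n : ℕ) :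
    halfGaussianMoment n =
      (1 / 2 : ℝ) ^ (-((n : ℝ) + 1) / 2) * (1 / 2) * Real.Gamma (((n : ℝ) + 1) / 2) := by
  have h := integral_rpow_mul_exp_neg_mul_rpow (p := 2) (q := n) (b := 1 / 2) (by norm_num)
    (by have := n.cast_nonneg (α := ℝ); linarith) (by norm_num)
  rw [← h]
  refine setIntegral_congr_fun measurableSet_Ioi fun z _ => ?_
  simp

lemma halfGaussianMoment_add_two (n : ℕ) :
    halfGaussianMoment (n + 2) = (n + 1) * halfGaussianMoment n := by
  have hn : (0 : ℝ) < ((n : ℝ) + 1) / 2 := by positivity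
  rw [halfGaussianMoment_eq, halfGaussianMoment_eq]
  have e1 : (((n + 2 : ℕ) : ℝ) + 1) / 2 = ((n : ℝ) + 1) / 2 + 1 := by push_cast; ring
  have e2 : -(((n + 2 : ℕ) : ℝ) + 1) / 2 = -((n : ℝ) + 1) / 2 - 1 := by push_cast; ring
  rw [e1, e2, Real.Gamma_add_one hn.ne', Real.rpow_sub_one (by norm_num)]
  ring

lemma halfGaussianMoment_zero : halfGaussianMoment 0 = √(2 * Real.pi) / 2 := by
  rw [halfGaussianMoment_eq]
  have e : (1 / 2 : ℝ) ^ (-(((0 : ℕ) : ℝ) + 1) / 2) = √2 := by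
    rw [Real.sqrt_eq_rpow, one_div, ← Real.rpow_neg_one, ← Real.rpow_mul (by norm_num)]
    norm_num
  rw [e]
  norm_num [Real.Gamma_one_half_eq]
  ring

lemma halfGaussianMoment_one : halfGaussianMoment 1 = 1 := by
  rw [halfGaussianMoment_eq]
  norm_num [Real.rpow_neg_one]

lemma integral_max_zero_pow_gaussianReal {n : ℕ} (hn : n ≠ 0) :
    ∫ z, max z 0 ^ n ∂gaussianReal 0 1 = (√(2 * Real.pi))⁻¹ * halfGaussianMoment n := by
  rw [integral_gaussianReal_eq_integral_smul one_ne_zero, halfGaussianMoment,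
    ← integral_const_mul, ← integral_indicator measurableSet_Ioi]
  congr 1 with z
  by_cases hz : 0 < z
  · simp only [gaussianPDFReal, Set.indicator, Set.mem_Ioi, hz, if_true, max_eq_left hz.le,
      smul_eq_mul, NNReal.coe_one, mul_one, sub_zero]
    rw [show -z ^ 2 / 2 = -(1 / 2) * z ^ 2 by ring]
    ring
  · simp [Set.indicator, hz, max_eq_right (not_lt.1 hz), hn]

lemma memLp_affine_gaussianReal (a c : ℝ) (v : ℝ≥0) (n : ℕ) :
    MemLp (fun z => a + c * z) n (gaussianReal 0 v) :=
  (memLp_const a).add ((memLp_id_gaussianReal' n (by simp)).const_mul c)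

lemma integrable_affine_pow_gaussianReal (a c : ℝ) (v : ℝ≥0) (n : ℕ) :
    Integrable (fun z => (a + c * z) ^ n) (gaussianReal 0 v) := by
  have h := (memLp_affine_gaussianReal a c v n).integrable_norm_pow'
  refine h.mono' (by fun_prop) (ae_of_all _ fun z => ?_)
  simp

lemma integrable_max_affine_pow_gaussianReal (a c : ℝ) (v : ℝ≥0) (n : ℕ) :
    Integrable (fun z => max (a + c * z) 0 ^ n) (gaussianReal 0 v) := by
  have h := (memLp_affine_gaussianReal a c v n).integrable_norm_pow'
  refine h.mono' (by fun_prop) (ae_of_all _ fun z => ?_)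
  rw [norm_pow]
  gcongr
  rw [Real.norm_eq_abs, Real.norm_eq_abs, abs_of_nonneg (le_max_right _ _)]
  exact max_le (le_abs_self _) (abs_nonneg _)

lemma integral_max_affine_neg_gaussianReal (a c : ℝ) (v : ℝ≥0) (n : ℕ) :
    ∫ z, max (a + -c * z) 0 ^ n ∂gaussianReal 0 v =
      ∫ z, max (a + c * z) 0 ^ n ∂gaussianReal 0 v := by
  have h := gaussianReal_map_neg (μ := 0) (v := v)
  rw [neg_zero] at h
  conv_rhs => rw [← h]
  rw [integral_map (by fun_prop) (by fun_prop)]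
  simp

lemma integral_pow_gaussianReal {n : ℕ} (hn : n ≠ 0) :
    ∫ z, z ^ n ∂gaussianReal 0 1 =
      (1 + (-1) ^ n) * ((√(2 * Real.pi))⁻¹ * halfGaussianMoment n) := by
  have h := integral_max_affine_neg_gaussianReal 0 1 1 n
  have i1 := integrable_max_affine_pow_gaussianReal 0 1 1 n
  have i2 := integrable_max_affine_pow_gaussianReal 0 (-1) 1 n
  simp only [zero_add, one_mul] at h i1 i2
  calc ∫ z, z ^ n ∂gaussianReal 0 1
      = ∫ z, (max z 0 ^ n + (-1) ^ n * max (-1 * z) 0 ^ n) ∂gaussianReal 0 1 := by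
        congr 1 with z
        rcases le_total z 0 with hz | hz
        · rw [max_eq_right hz, max_eq_left (by linarith), zero_pow hn, ← mul_pow]
          ring
        · rw [max_eq_left hz, max_eq_right (by linarith), zero_pow hn]
          ring
    _ = _ := by
        rw [integral_add i1 (i2.const_mul _), integral_const_mul, h,
          integral_max_zero_pow_gaussianReal hn]
        ring

lemma sqrt_two_pi_pos : 0 < √(2 * Real.pi) := by positivity

lemma halfGaussianMoment_four : halfGaussianMoment 4 = √(2 * Real.pi) * (3 / 2) := by
  rw [halfGaussianMoment_add_two 2, halfGaussianMoment_add_two 0, halfGaussianMoment_zero]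
  norm_num
  ring

lemma halfGaussianMoment_five : halfGaussianMoment 5 = 8 := by
  rw [halfGaussianMoment_add_two 3, halfGaussianMoment_add_two 1, halfGaussianMoment_one]
  norm_num

lemma halfGaussianMoment_six : halfGaussianMoment 6 = √(2 * Real.pi) * (15 / 2) := by
  rw [halfGaussianMoment_add_two 4, halfGaussianMoment_four]
  norm_num
  ring

lemma integral_add_pow_five_gaussianReal (u : ℝ) :
    ∫ z, (z + u) ^ 5 ∂gaussianReal 0 1 = u ^ 5 + 10 * u ^ 3 + 15 * u := by
  have i (k : ℕ) : Integrable (fun z : ℝ => z ^ k) (gaussianReal 0 1) := by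
    simpa using integrable_affine_pow_gaussianReal 0 1 1 k
  have m1 := integral_pow_gaussianReal (n := 1) (by norm_num)
  have m2 := integral_pow_gaussianReal (n := 2) (by norm_num)
  have m3 := integral_pow_gaussianReal (n := 3) (by norm_num)
  have m4 := integral_pow_gaussianReal (n := 4) (by norm_num)
  have m5 := integral_pow_gaussianReal (n := 5) (by norm_num)
  rw [halfGaussianMoment_add_two 0, halfGaussianMoment_zero] at m2
  rw [halfGaussianMoment_four] at m4
  have e : ∀ z : ℝ, (z + u) ^ 5 = z ^ 5 + 5 * u * z ^ 4 + 10 * u ^ 2 * z ^ 3 +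
      10 * u ^ 3 * z ^ 2 + 5 * u ^ 4 * z ^ 1 + u ^ 5 := fun z => by ring
  simp_rw [e]
  rw [integral_add (by fun_prop (disch := assumption)) (integrable_const _), integral_add,
    integral_add, integral_add, integral_add]
  · simp only [integral_const_mul, m1, m2, m3, m4, m5, integral_const]
    have := sqrt_two_pi_pos.ne'
    simp
    field_simp
    ring
  all_goals
    first
    | exact i _
    | exact (i _).const_mul _
    | fun_prop (disch := assumption)

/-! ### Lower bounds for `E[(Z - t)₊⁵]`. -/

/-- `E[(Z - t)₊⁵]` for `Z` standard normal. -/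
noncomputable def gaussianPosPart (t : ℝ) : ℝ := ∫ z, max (z - t) 0 ^ 5 ∂gaussianReal 0 1

lemma integrable_max_sub_pow_five (t : ℝ) :
    Integrable (fun z : ℝ => max (z - t) 0 ^ 5) (gaussianReal 0 1) := by
  have := integrable_max_affine_pow_gaussianReal (-t) 1 1 5
  refine this.congr (ae_of_all _ fun z => ?_)
  simp only [one_mul, neg_add_eq_sub]

lemma gaussianPosPart_nonneg (t : ℝ) : 0 ≤ gaussianPosPart t :=
  integral_nonneg fun z => by positivity

/-- From `w₊⁵ - (-w)₊⁵ = w⁵` at `w = z + u` and the symmetry of `Z`. -/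
lemma gaussianPosPart_neg (u : ℝ) :
    gaussianPosPart (-u) = u ^ 5 + 10 * u ^ 3 + 15 * u + gaussianPosPart u := by
  have h := integral_max_affine_neg_gaussianReal (-u) 1 1 5
  have i := integrable_max_affine_pow_gaussianReal (-u) (-1) 1 5
  have i' := integrable_affine_pow_gaussianReal u 1 1 5
  rw [← integral_add_pow_five_gaussianReal, gaussianPosPart, gaussianPosPart]
  have h' : ∫ z, max (z - u) 0 ^ 5 ∂gaussianReal 0 1
      = ∫ z, max (-u + -1 * z) 0 ^ 5 ∂gaussianReal 0 1 := by
    rw [h]; congr 1 with z; rw [one_mul, neg_add_eq_sub]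
  rw [h', ← integral_add (by simpa [add_comm] using i') i]
  congr 1 with z
  rcases le_total 0 (z + u) with hz | hz
  · rw [max_eq_left (by linarith), max_eq_right (by linarith)]; ring
  · rw [max_eq_right (by linarith), max_eq_left (by linarith)]; ring

/-- Tangent line at `0` of a convex function of `u`; its slope is `-5 E[Z₊⁴] = -15/2`. -/
lemma le_gaussianPosPart_tangent {u : ℝ} (hu : 0 ≤ u) :
    8 / √(2 * Real.pi) - 15 / 2 * u ≤ gaussianPosPart u := by
  have i4 := integrable_max_affine_pow_gaussianReal 0 1 1 4
  have i5 := integrable_max_affine_pow_gaussianReal 0 1 1 5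
  simp only [zero_add, one_mul] at i4 i5
  have e : 8 / √(2 * Real.pi) - 15 / 2 * u =
      ∫ z, (max z 0 ^ 5 - 5 * u * max z 0 ^ 4) ∂gaussianReal 0 1 := by
    rw [integral_sub i5 (i4.const_mul _), integral_const_mul,
      integral_max_zero_pow_gaussianReal (by norm_num),
      integral_max_zero_pow_gaussianReal (by norm_num), halfGaussianMoment_four,
      halfGaussianMoment_five]
    have := sqrt_two_pi_pos.ne'
    field_simp
    ring
  rw [e]
  refine integral_mono (i5.sub (i4.const_mul _)) (integrable_max_sub_pow_five u) fun z => ?_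
  simp only
  rcases le_total z 0 with hz | hz
  · rw [max_eq_right hz, max_eq_right (by linarith)]; simp
  rw [max_eq_left hz]
  rcases le_total z u with h | h
  · rw [max_eq_right (by linarith)]
    nlinarith [mul_nonneg (pow_nonneg hz 4) (by linarith : 0 ≤ 5 * u - z)]
  · rw [max_eq_left (by linarith)]
    obtain ⟨d, hd, rfl⟩ : ∃ d, 0 ≤ d ∧ z = u + d := ⟨z - u, by linarith, by ring⟩
    have : 0 ≤ 10 * u ^ 2 * d ^ 3 + 20 * u ^ 3 * d ^ 2 + 15 * u ^ 4 * d + 4 * u ^ 5 := by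
      positivity
    nlinarith only [this]

lemma gaussianPosPart_eq_integral_exp (t : ℝ) :
    gaussianPosPart t =
      ∫ z, Real.exp (-t * z - t ^ 2 / 2) * max z 0 ^ 5 ∂gaussianReal 0 1 := by
  rw [gaussianPosPart, integral_gaussianReal_eq_integral_smul one_ne_zero,
    integral_gaussianReal_eq_integral_smul one_ne_zero,
    ← integral_add_right_eq_self _ t]
  congr 1 with z
  simp only [gaussianPDFReal, smul_eq_mul, NNReal.coe_one, mul_one, sub_zero, add_sub_cancel_right]
  rw [← mul_assoc, mul_assoc _ (Real.exp _) (Real.exp _), ← Real.exp_add]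
  ring_nf

/-- After the shift `z ↦ z + t` this is Jensen for `exp(-t z)` under the weight `z₊⁵`. The weighted
mean is `E[Z₊⁶] / E[Z₊⁵] = 15 √(2π) / 16 ≈ 2.35`, rounded up to `2.36`; the exponential is replaced
by its tangent there. -/
lemma le_gaussianPosPart_exp {t : ℝ} (ht : 0 ≤ t) :
    8 / √(2 * Real.pi) * Real.exp (-t ^ 2 / 2 - 2.36 * t) ≤ gaussianPosPart t := by
  have i6 := integrable_max_affine_pow_gaussianReal 0 1 1 6
  have i5 := integrable_max_affine_pow_gaussianReal 0 1 1 5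
  simp only [zero_add, one_mul] at i6 i5
  set E := Real.exp (-t ^ 2 / 2 - 2.36 * t) with hE
  have e : ∫ z, E * ((1 + 2.36 * t) * max z 0 ^ 5 - t * max z 0 ^ 6) ∂gaussianReal 0 1 =
      E * ((1 + 2.36 * t) * (8 / √(2 * Real.pi)) - t * (15 / 2)) := by
    rw [integral_const_mul, integral_sub (i5.const_mul _) (i6.const_mul _), integral_const_mul,
      integral_const_mul, integral_max_zero_pow_gaussianReal (by norm_num),
      integral_max_zero_pow_gaussianReal (by norm_num), halfGaussianMoment_six,
      halfGaussianMoment_five]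
    have := sqrt_two_pi_pos.ne'
    field_simp
  have hpi : √(2 * Real.pi) ≤ 2.51 := by
    rw [Real.sqrt_le_left (by norm_num)]
    have := Real.pi_lt_d2
    norm_num at this ⊢
    linarith
  have h1 : 15 / 2 ≤ 2.36 * (8 / √(2 * Real.pi)) := by
    rw [← mul_div_assoc, le_div_iff₀ sqrt_two_pi_pos]
    linarith
  calc 8 / √(2 * Real.pi) * E
      ≤ E * ((1 + 2.36 * t) * (8 / √(2 * Real.pi)) - t * (15 / 2)) := by
        rw [mul_comm]
        refine mul_le_mul_of_nonneg_left ?_ (Real.exp_pos _).le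
        nlinarith [mul_le_mul_of_nonneg_left h1 ht]
    _ ≤ gaussianPosPart t := by
        rw [← e, gaussianPosPart_eq_integral_exp]
        refine integral_mono (((i5.const_mul _).sub (i6.const_mul _)).const_mul _) ?_ fun z => ?_
        · refine i5.mono' (by fun_prop) (ae_of_all _ fun z => ?_)
          rw [norm_mul, Real.norm_of_nonneg (Real.exp_pos _).le,
            Real.norm_of_nonneg (by positivity)]
          rcases le_total z 0 with hz | hz
          · simp [max_eq_right hz]
          · refine mul_le_of_le_one_left (by positivity) (Real.exp_le_one_iff.2 ?_)
            nlinarith [mul_nonneg ht hz, sq_nonneg t]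
        · simp only
          rcases le_total z 0 with hz | hz
          · simp [max_eq_right hz]
          · have h2 : Real.exp (-t * z - t ^ 2 / 2) = E * Real.exp (-t * (z - 2.36)) := by
              rw [hE, ← Real.exp_add]; ring_nf
            rw [h2, max_eq_left hz, mul_assoc]
            refine mul_le_mul_of_nonneg_left ?_ (Real.exp_pos _).le
            have h3 := Real.add_one_le_exp (-t * (z - 2.36))
            nlinarith [mul_le_mul_of_nonneg_right h3 (pow_nonneg hz 5)]

/-! ### Centred two-point laws against the normal law. -/

lemma two_point_poly_aux {c y : ℝ} (hc : 0.225 ≤ c) (hy : 0 ≤ y) :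
    0 ≤ 10 * c * (1 - c) ^ 2 + y * (20 * c ^ 2 - 10 * c - 4) + 15 * c * y ^ 2 + 4 * y ^ 3 := by
  -- Gives `4y³ ≥ 3.6y² - 0.81y`, so that a quadratic in `y` with a discriminant bound remains.
  have h1 : 0 ≤ y * (y - 0.45) ^ 2 := by positivity
  rcases le_total (0.81 + 4 + 10 * c - 20 * c ^ 2) 0 with h | h
  · nlinarith [mul_nonneg hy (neg_nonneg.2 h), mul_nonneg (by linarith : 0 ≤ c) (sq_nonneg (1 - c)),
      mul_nonneg (by linarith : 0 ≤ c) (sq_nonneg y), sq_nonneg y]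
  have hc2 : c ≤ 0.81 := by nlinarith
  have hd : (4.81 + 10 * c - 20 * c ^ 2) ^ 2 ≤ 40 * c * (1 - c) ^ 2 * (15 * c + 3.6) := by
    nlinarith [mul_nonneg (sub_nonneg.2 hc) (sub_nonneg.2 hc2), sq_nonneg (c - 0.81),
      mul_nonneg (mul_nonneg (sub_nonneg.2 hc) (sub_nonneg.2 hc2)) (sq_nonneg (c - 0.7)),
      mul_nonneg (sub_nonneg.2 hc) (sq_nonneg (c - 0.8)), sq_nonneg (c * (c - 0.8))]
  have hA : 0 < 15 * c + 3.6 := by linarith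
  have h2 : 0 ≤ (15 * c + 3.6) * y ^ 2 - (4.81 + 10 * c - 20 * c ^ 2) * y
      + 10 * c * (1 - c) ^ 2 := by
    refine nonneg_of_mul_nonneg_right (a := 4 * (15 * c + 3.6)) ?_ (by linarith)
    nlinarith [sq_nonneg (2 * (15 * c + 3.6) * y - (4.81 + 10 * c - 20 * c ^ 2))]
  nlinarith

lemma two_point_poly_large {e u : ℝ} (he : 0 < e) (hu : 1 - e ≤ u)
    (hu' : 0.35 ≤ u) :
    0 ≤ 10 * u ^ 3 * e ^ 2 - 20 * u ^ 2 * e + 20 * u ^ 2 * e ^ 3 + 10 * u - 10 * u * e ^ 2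
      + 15 * u * e ^ 4 - 4 * e + 4 * e ^ 5 := by
  -- Multiplied by `e`, the expression is a polynomial in `c = u e` and `e²`.
  set c := u * e with hc
  have hcpos : 0 < c := by positivity
  suffices h : 0 ≤ 10 * c * (1 - c) ^ 2 + e ^ 2 * (20 * c ^ 2 - 10 * c - 4)
      + 15 * c * (e ^ 2) ^ 2 + 4 * (e ^ 2) ^ 3 by
    refine nonneg_of_mul_nonneg_right (a := e) ?_ he
    rw [hc] at h
    linarith
  rcases le_total 0.225 c with h | h
  · exact two_point_poly_aux h (sq_nonneg e)
  have h1 : 0.35 * e ≤ c := by rw [hc]; gcongr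
  have h2 : (1 - e) * e ≤ c := by rw [hc]; gcongr
  have h3 : e ≤ 0.35 := by nlinarith
  have h4 : 0.65 * e ≤ c := by nlinarith
  have h5 : e ^ 2 ≤ 0.54 * c := by nlinarith
  have h6 : e ^ 2 ≤ 0.1225 := by nlinarith
  nlinarith [mul_nonneg hcpos.le (sub_nonneg.2 h6), mul_nonneg hcpos.le (sub_nonneg.2 h),
    mul_nonneg hcpos.le (sq_nonneg c), mul_nonneg hcpos.le (sq_nonneg (e ^ 2)), pow_nonneg he.le 6,
    mul_nonneg (sq_nonneg e) (sq_nonneg c)]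

lemma two_point_poly_small {e u : ℝ} (he : 0 < e) (he1 : e ≤ 1) (hu : 1 - e ≤ u)
    (hu' : u ≤ 0.35) :
    0 ≤ 10 * u ^ 3 * e ^ 2 - 20 * u ^ 2 * e + 20 * u ^ 2 * e ^ 3 + 10 * u - 10 * u * e ^ 2
      + 15 * u * e ^ 4 - 4 * e + 4 * e ^ 5 + (3.19 - 7.5 * u) := by
  have hu0 : 0 ≤ u := by linarith
  have h1 : 0 ≤ (1 - e ^ 2) := by nlinarith
  have he2 : 0.65 ≤ e := by linarith
  have hA : 0 ≤ 3.19 - 7.5 * 0.35 - 4 * e + 4 * e ^ 5 + 15 * 0.35 * e ^ 4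
      + 0.35 * (10 - 20 * 0.35 * e) * (1 - e ^ 2) := by
    obtain ⟨d, hd, rfl⟩ : ∃ d, 0 ≤ d ∧ e = 0.65 + d := ⟨e - 0.65, by linarith, by ring⟩
    ring_nf
    nlinarith [pow_nonneg hd 5, pow_nonneg hd 4, pow_nonneg hd 3, pow_nonneg hd 2, hd]
  have hB : 0 ≤ 3.19 - 7.5 * (1 - e) - 4 * e + 4 * e ^ 5 + 15 * (1 - e) * e ^ 4
      + (1 - e) * (10 - 20 * (1 - e) * e) * (1 - e ^ 2) := by
    obtain ⟨d, hd, rfl⟩ : ∃ d, 0 ≤ d ∧ e = 0.65 + d := ⟨e - 0.65, by linarith, by ring⟩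
    have hd1 : d ≤ 0.35 := by linarith
    ring_nf
    nlinarith [pow_nonneg hd 5, pow_nonneg hd 4, pow_nonneg hd 3, pow_nonneg hd 2, hd,
      mul_nonneg hd (sub_nonneg.2 hd1), mul_nonneg (pow_nonneg hd 2) (sub_nonneg.2 hd1),
      mul_nonneg (pow_nonneg hd 3) (sub_nonneg.2 hd1)]
  -- For fixed `e` this is concave in `u`, so the endpoints `u = 0.35` (`hA`) and `u = 1 - e` (`hB`)
  -- decide; `a3` below is the excess over the chord.
  have hD : 0 ≤ 3.19 - 7.5 * u - 4 * e + 4 * e ^ 5 + 15 * u * e ^ 4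
      + u * (10 - 20 * u * e) * (1 - e ^ 2) := by
    rcases he2.eq_or_lt with rfl | h
    · obtain rfl : u = 0.35 := by norm_num at hu hu' ⊢; linarith
      norm_num
    · refine nonneg_of_mul_nonneg_right (a := e - 0.65) ?_ (by linarith)
      have a1 := mul_nonneg hA (by linarith : 0 ≤ u - (1 - e))
      have a2 := mul_nonneg hB (by linarith : 0 ≤ 0.35 - u)
      have a3 : 0 ≤ 20 * e * (1 - e ^ 2) * ((e - 0.65) * ((u - (1 - e)) * (0.35 - u))) := by
        refine mul_nonneg (by positivity) (mul_nonneg (by linarith)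
          (mul_nonneg (by linarith) (by linarith)))
      linarith
  have : 0 ≤ 10 * u ^ 3 * e ^ 2 := by positivity
  linarith

/-- Both atoms lie above the level `-u`, so only fifth moments are compared. In terms of `e = 1 -
2p`, every term has the right sign if `e ≤ 0`; the remainder `r` is needed only for `e > 0` and
small `u`. -/
lemma two_point_poly {p u r : ℝ} (hp0 : 0 ≤ p) (hp1 : p ≤ 1) (hu : 2 * p ≤ u) (hr : 0 ≤ r)
    (hr' : 3.19 - 7.5 * u ≤ r) :
    p * (2 * (1 - p) + u) ^ 5 + (1 - p) * (-2 * p + u) ^ 5 ≤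
      u ^ 5 + 10 * u ^ 3 + 15 * u + r := by
  obtain ⟨e, he⟩ : ∃ e, e = 1 - 2 * p := ⟨_, rfl⟩
  obtain rfl : p = (1 - e) / 2 := by linarith
  have hu0 : 0 ≤ u := by linarith
  have key : 0 ≤ 10 * u ^ 3 * e ^ 2 - 20 * u ^ 2 * e + 20 * u ^ 2 * e ^ 3 + 10 * u
      - 10 * u * e ^ 2 + 15 * u * e ^ 4 - 4 * e + 4 * e ^ 5 + r := by
    rcases le_or_gt e 0 with h | h
    · obtain ⟨d, rfl⟩ : ∃ d, e = -d := ⟨-e, by ring⟩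
      have hd : 0 ≤ d := by linarith
      have h1 : 0 ≤ 1 - d ^ 2 := by nlinarith
      have : 0 ≤ 10 * u ^ 3 * d ^ 2 + 20 * u ^ 2 * d * (1 - d ^ 2) + 10 * u * (1 - d ^ 2)
        + 15 * u * d ^ 4 + 4 * d * ((1 - d ^ 2) * (1 + d ^ 2)) := by positivity
      nlinarith only [this, hr]
    · rcases le_total 0.35 u with h' | h'
      · linarith [two_point_poly_large h (by linarith) h']
      · linarith [two_point_poly_small h (by linarith) (by linarith) h']
  nlinarith only [key]

lemma le_eight_div_sqrt_two_pi : 3.19 ≤ 8 / √(2 * Real.pi) := by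
  rw [le_div_iff₀ sqrt_two_pi_pos]
  have hpi : √(2 * Real.pi) ≤ 2.507 := by
    rw [Real.sqrt_le_left (by norm_num)]
    have := Real.pi_lt_d4
    norm_num at this ⊢
    linarith
  linarith

lemma le_gaussianPosPart_neg {u : ℝ} (hu : 0 ≤ u) :
    u ^ 5 + 10 * u ^ 3 + 15 * u + max 0 (3.19 - 7.5 * u) ≤ gaussianPosPart (-u) := by
  rw [gaussianPosPart_neg]
  gcongr
  refine max_le (gaussianPosPart_nonneg u) ?_
  linarith [le_gaussianPosPart_tangent hu, le_eight_div_sqrt_two_pi]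

lemma one_sub_pow_six_le {t : ℝ} (h0 : 0 ≤ t) (h2 : t ≤ 2) :
    2.15 * (1 - t / 2) ^ 6 ≤ 3.19 * Real.exp (-t ^ 2 / 2 - 2.36 * t) := by
  obtain ⟨y, rfl⟩ : ∃ y, t = 2 * y := ⟨t / 2, by ring⟩
  have hy0 : 0 ≤ y := by linarith
  have hy1 : y ≤ 1 := by linarith
  -- The sixth root of the claim: `0.937 ^ 6` slightly exceeds `2.15 / 3.19`.
  have key : 0.937 * (1 - y) ≤ Real.exp (-(y ^ 2 / 3) - 2.36 / 3 * y) := by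
    rcases le_total y 0.7 with h | h
    · refine le_trans ?_ (Real.add_one_le_exp _)
      nlinarith
    · have h1 : 0.36 ≤ Real.exp (-1) := by
        rw [Real.exp_neg, le_inv_comm₀ (by norm_num) (Real.exp_pos _)]
        have := Real.exp_one_lt_d9
        norm_num at this ⊢
        linarith
      have h2 := Real.add_one_le_exp (-0.121 : ℝ)
      calc 0.937 * (1 - y) ≤ 0.36 * (-0.121 + 1) := by linarith
        _ ≤ Real.exp (-1) * Real.exp (-0.121) := by gcongr
        _ = Real.exp (-1.121) := by rw [← Real.exp_add]; norm_num
        _ ≤ _ := Real.exp_le_exp.2 (by nlinarith)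
  have h6 := pow_le_pow_left₀ (by nlinarith) key 6
  rw [← Real.exp_nat_mul] at h6
  have e : ((6 : ℕ) : ℝ) * (-(y ^ 2 / 3) - 2.36 / 3 * y) =
    -(2 * y) ^ 2 / 2 - 2.36 * (2 * y) := by push_cast; ring
  rw [e, mul_pow] at h6
  have h0 : 0 ≤ (1 - y) ^ 6 := by positivity
  rw [mul_div_cancel_left₀ y two_ne_zero]
  norm_num at h6 ⊢
  linarith

/-- The maximum over `p` of `p (2 (1 - p) - t)⁵`. -/
lemma mul_pow_five_le {p t : ℝ} (hp : 0 ≤ p) (h : 0 ≤ 2 * (1 - p) - t) :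
    p * (2 * (1 - p) - t) ^ 5 ≤ 3125 / 93312 * (2 - t) ^ 6 := by
  obtain ⟨q, hq⟩ : ∃ q, q = 2 * (1 - p) - t := ⟨_, rfl⟩
  obtain rfl : t = 2 * (1 - p) - q := by linarith
  rw [← hq] at h ⊢
  have e : 2 - (2 * (1 - p) - q) = 2 * p + q := by ring
  rw [e]
  -- With `2p + q` fixed, `p q⁵` is largest at `q = 10p`, which is why a double root factors out.
  have : 0 ≤ (10 * p - q) ^ 2 * ((10 * p) ^ 4 + 32 * (10 * p) ^ 3 * q + 438 * (10 * p) ^ 2 * q ^ 2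
      + 3344 * (10 * p) * q ^ 3 + 15625 * q ^ 4) := by positivity
  nlinarith only [this]

/-- The level `t` lies below both atoms (polynomial comparison), above both (trivial), or between
them. In the last case only `p (2(1 - p) - t)⁵` survives. It is maximised over `p` when `t ≥ -0.4`;
for lower `t` the constraint `-t ≤ 2p` gives the better bound `16u`, `u = -t`. -/
lemma two_point_le_gaussianPosPart {p : ℝ} (hp0 : 0 ≤ p) (hp1 : p ≤ 1) (t : ℝ) :
    p * max (2 * (1 - p) - t) 0 ^ 5 + (1 - p) * max (-2 * p - t) 0 ^ 5 ≤ gaussianPosPart t := by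
  rcases le_total t (-2 * p) with h | h
  · obtain ⟨u, rfl⟩ : ∃ u, t = -u := ⟨-t, by ring⟩
    rw [max_eq_left (by linarith), max_eq_left (by linarith), sub_neg_eq_add, sub_neg_eq_add]
    exact (two_point_poly hp0 hp1 (by linarith) (le_max_left _ _) (le_max_right _ _)).trans
      (le_gaussianPosPart_neg (by linarith))
  rw [max_eq_right (by linarith : -2 * p - t ≤ 0), zero_pow (by norm_num), mul_zero, add_zero]
  rcases le_total (2 * (1 - p) - t) 0 with h' | h'
  · rw [max_eq_right h']
    simpa using gaussianPosPart_nonneg t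
  rw [max_eq_left h']
  rcases le_total 0 t with ht | ht
  · have h1 := one_sub_pow_six_le ht (by linarith)
    have h2 := mul_pow_five_le hp0 h'
    have h3 := le_gaussianPosPart_exp ht
    have h4 := mul_le_mul_of_nonneg_right le_eight_div_sqrt_two_pi
      (Real.exp_pos (-t ^ 2 / 2 - 2.36 * t)).le
    have h5 : (2 - t) ^ 6 = 64 * (1 - t / 2) ^ 6 := by ring
    have h6 : 0 ≤ (1 - t / 2) ^ 6 := by positivity
    linarith
  obtain ⟨u, rfl⟩ : ∃ u, t = -u := ⟨-t, by ring⟩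
  have hu : 0 ≤ u := by linarith
  have hF := le_gaussianPosPart_neg hu
  rcases le_total u 0.4 with h4 | h4
  · refine (mul_pow_five_le hp0 h').trans (le_trans ?_ hF)
    have h5 := le_max_right 0 (3.19 - 7.5 * u)
    nlinarith [pow_nonneg hu 2, pow_nonneg hu 3, pow_nonneg hu 4, pow_nonneg hu 5,
      mul_nonneg hu (sub_nonneg.2 h4), mul_nonneg (pow_nonneg hu 2) (sub_nonneg.2 h4),
      mul_nonneg (pow_nonneg hu 3) (sub_nonneg.2 h4),
      mul_nonneg (pow_nonneg hu 4) (sub_nonneg.2 h4),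
      mul_nonneg (pow_nonneg hu 5) (sub_nonneg.2 h4)]
  · refine le_trans ?_ hF
    have h5 := le_max_left 0 (3.19 - 7.5 * u)
    have h6 : p * (2 * (1 - p) - -u) ^ 5 ≤ 16 * u := by
      obtain ⟨q, hq⟩ : ∃ q, q = 2 * (1 - p) - -u := ⟨_, rfl⟩
      obtain rfl : p = (2 + u - q) / 2 := by linarith
      rw [← hq] at h' ⊢
      have hq2 : 0 ≤ 2 - q := by linarith
      -- The threshold `0.4` makes this an equality at `q = 2`.
      have b1 : q ^ 5 ≤ 0.4 * (16 + 8 * q + 4 * q ^ 2 + 2 * q ^ 3 + q ^ 4) := by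
        nlinarith only [mul_nonneg hq2 (pow_nonneg h' 4), mul_nonneg hq2 (pow_nonneg h' 3),
          mul_nonneg hq2 (pow_nonneg h' 2), mul_nonneg hq2 h', hq2]
      have b2 := mul_le_mul_of_nonneg_left b1 hq2
      have b3 : 0 ≤ (u - 0.4) * ((2 - q) * (16 + 8 * q + 4 * q ^ 2 + 2 * q ^ 3 + q ^ 4)) :=
        mul_nonneg (by linarith) (by positivity)
      linarith
    have h7 : u ≤ u ^ 5 + 10 * u ^ 3 := by
      have : 1 ≤ u ^ 4 + 10 * u ^ 2 := by nlinarith [sq_nonneg (u ^ 2)]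
      nlinarith
    linarith

/-! ### Reduction to two-point laws. -/

/-- Monotonicity in `w` of the second divided difference of `w ↦ w₊⁵` at the node `c, c`. -/
lemma posPart_divided_difference_le {c w w' : ℝ} (hw : w ≤ w') (hc : c ≤ w') :
    (max w 0 ^ 5 - max c 0 ^ 5 - 5 * max c 0 ^ 4 * (w - c)) * (w' - c) ^ 2 ≤
      (max w' 0 ^ 5 - max c 0 ^ 5 - 5 * max c 0 ^ 4 * (w' - c)) * (w - c) ^ 2 := by
  rcases le_total c 0 with h | h
  · rw [max_eq_right h]
    rcases le_total w 0 with h0 | h0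
    · rw [max_eq_right h0]
      norm_num
      positivity
    rw [max_eq_left h0, max_eq_left (h0.trans hw)]
    have h1 : w * (w' - c) ≤ w' * (w - c) := by nlinarith
    have h2 : (w * (w' - c)) ^ 2 ≤ (w' * (w - c)) ^ 2 :=
      pow_le_pow_left₀ (mul_nonneg h0 (by linarith)) h1 2
    have h3 := mul_le_mul (pow_le_pow_left₀ h0 hw 3) h2 (sq_nonneg _) (pow_nonneg (h0.trans hw) 3)
    norm_num
    linarith
  rw [max_eq_left h, max_eq_left (h.trans hc)]
  have e (x : ℝ) : x ^ 5 - c ^ 5 - 5 * c ^ 4 * (x - c) =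
      (x ^ 3 + 2 * x ^ 2 * c + 3 * x * c ^ 2 + 4 * c ^ 3) * (x - c) ^ 2 := by ring
  rw [e w']
  rcases le_total 0 w with h0 | h0
  · rw [max_eq_left h0, e w, mul_right_comm]
    refine mul_le_mul_of_nonneg_right ?_ (sq_nonneg _)
    refine mul_le_mul_of_nonneg_right ?_ (sq_nonneg _)
    gcongr
  · rw [max_eq_right h0, mul_right_comm _ ((w' - c) ^ 2)]
    refine mul_le_mul_of_nonneg_right ?_ (sq_nonneg _)
    have h1 : 10 * c ^ 3 ≤ w' ^ 3 + 2 * w' ^ 2 * c + 3 * w' * c ^ 2 + 4 * c ^ 3 := by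
      have : c ^ 3 + 2 * c ^ 2 * c + 3 * c * c ^ 2 + 4 * c ^ 3 ≤
        w' ^ 3 + 2 * w' ^ 2 * c + 3 * w' * c ^ 2 + 4 * c ^ 3 := by gcongr
      linarith
    have h2 := mul_le_mul_of_nonneg_right h1 (sq_nonneg (w - c))
    have h3 : 0 ≤ c ^ 3 * (6 * c ^ 2 + 15 * c * -w + 10 * w ^ 2) := by
      have : 0 ≤ -w := by linarith
      positivity
    nlinarith

/-- Convexity of `w₊⁵`; it gives `γ ≥ 0` in the majorant and Jensen for `smoothPosPart`. -/
lemma posPart_tangent_le (A w : ℝ) :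
    max A 0 ^ 5 + 5 * max A 0 ^ 4 * w ≤ max (A + w) 0 ^ 5 := by
  have h1 : ∀ x y : ℝ, 0 ≤ x → 0 ≤ y → x ^ 5 + 5 * x ^ 4 * (y - x) ≤ y ^ 5 := fun x y hx hy => by
    have : 0 ≤ (y ^ 3 + 2 * y ^ 2 * x + 3 * y * x ^ 2 + 4 * x ^ 3) * (y - x) ^ 2 := by positivity
    linarith
  rcases le_total A 0 with h | h
  · rw [max_eq_right h]
    norm_num
  · have h2 := h1 A (max (A + w) 0) h (le_max_right _ _)
    rw [max_eq_left h]
    have h3 := mul_le_mul_of_nonneg_left (le_max_left (A + w) 0) (pow_nonneg h 4)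
    linarith

/-- The quadratic touching `x ↦ (x - t)₊⁵` at `-a` and meeting it at `b` majorizes it on
`(-∞, b]`. -/
lemma exists_quadratic_majorant {a b : ℝ} (ha : 0 ≤ a) (hb : 0 < b) (t : ℝ) :
    ∃ α β γ : ℝ, 0 ≤ β ∧ 0 ≤ γ ∧ (∀ x ≤ b, max (x - t) 0 ^ 5 ≤ α + β * x + γ * x ^ 2) ∧
      α + γ * (a * b) = (a * max (b - t) 0 ^ 5 + b * max (-a - t) 0 ^ 5) / (a + b) := by
  have hab : 0 < a + b := by linarith
  have hfc : 0 ≤ max (-a - t) 0 := le_max_right _ _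
  set y := max (-a - t) 0 with hy
  set z := max (b - t) 0 with hz
  -- The second divided difference at the nodes `-a, -a, b`.
  obtain ⟨γ, hγ⟩ : ∃ γ, γ = (z ^ 5 - y ^ 5 - 5 * y ^ 4 * (a + b)) / (a + b) ^ 2 := ⟨_, rfl⟩
  have hγ' : z ^ 5 = y ^ 5 + 5 * y ^ 4 * (a + b) + γ * (a + b) ^ 2 := by
    rw [hγ]; field_simp; ring
  have hγ0 : 0 ≤ γ := by
    have := posPart_tangent_le (-a - t) (a + b)
    rw [← hy, show -a - t + (a + b) = b - t by ring, ← hz] at this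
    rw [hγ]
    exact div_nonneg (by linarith) (by positivity)
  refine ⟨y ^ 5 + 5 * y ^ 4 * a + γ * a ^ 2, 5 * y ^ 4 + 2 * γ * a, γ, by positivity, hγ0,
    fun x hx => ?_, ?_⟩
  · have h := posPart_divided_difference_le (c := -a - t) (w := x - t) (w' := b - t)
      (by linarith) (by linarith)
    rw [← hy, ← hz, hγ', show b - t - (-a - t) = a + b by ring,
      show x - t - (-a - t) = x + a by ring] at h
    have h' : (max (x - t) 0 ^ 5 - y ^ 5 - 5 * y ^ 4 * (x + a)) * (a + b) ^ 2 ≤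
        (γ * (x + a) ^ 2) * (a + b) ^ 2 := by linarith
    have := le_of_mul_le_mul_right h' (by positivity)
    linarith
  -- The mean-zero law on `{-a, b}` has variance `a b`, and the quadratic agrees with the function
  -- at both atoms.
  · rw [hγ']; field_simp; ring

/-! ### Gaussian smoothing and domination of one variable. -/

/-- `E[(A + c Z)₊⁵]` for `Z` standard normal. -/
noncomputable def smoothPosPart (A c : ℝ) : ℝ≥0∞ :=
  ∫⁻ z, ENNReal.ofReal (max (A + c * z) 0 ^ 5) ∂gaussianReal 0 1

lemma smoothPosPart_eq_ofReal_integral (A c : ℝ) :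
    smoothPosPart A c = ENNReal.ofReal (∫ z, max (A + c * z) 0 ^ 5 ∂gaussianReal 0 1) := by
  rw [smoothPosPart, ofReal_integral_eq_lintegral_ofReal
    (integrable_max_affine_pow_gaussianReal A c 1 5) (ae_of_all _ fun z => by positivity)]

lemma smoothPosPart_zero_right (A : ℝ) : smoothPosPart A 0 = ENNReal.ofReal (max A 0 ^ 5) := by
  simp [smoothPosPart]

lemma smoothPosPart_mono_left {A A' : ℝ} (h : A ≤ A') (c : ℝ) :
    smoothPosPart A c ≤ smoothPosPart A' c := by
  unfold smoothPosPart
  gcongr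

lemma le_smoothPosPart (A c : ℝ) : ENNReal.ofReal (max A 0 ^ 5) ≤ smoothPosPart A c := by
  rw [smoothPosPart_eq_ofReal_integral]
  refine ENNReal.ofReal_le_ofReal ?_
  have i1 : Integrable (fun z : ℝ => z) (gaussianReal 0 1) := by
    simpa using integrable_affine_pow_gaussianReal 0 1 1 1
  calc max A 0 ^ 5 = ∫ z, (max A 0 ^ 5 + 5 * max A 0 ^ 4 * (c * z)) ∂gaussianReal 0 1 := by
        rw [integral_add (integrable_const _) ((i1.const_mul c).const_mul _), integral_const_mul,
          integral_const_mul, integral_id_gaussianReal]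
        simp
    _ ≤ _ := integral_mono ((integrable_const _).add ((i1.const_mul c).const_mul _))
        (integrable_max_affine_pow_gaussianReal A c 1 5) fun z => posPart_tangent_le A (c * z)

lemma measurable_smoothPosPart : Measurable fun p : ℝ × ℝ => smoothPosPart p.1 p.2 := by
  unfold smoothPosPart
  refine Measurable.lintegral_prod_right' (f := fun q : (ℝ × ℝ) × ℝ =>
    ENNReal.ofReal (max (q.1.1 + q.1.2 * q.2) 0 ^ 5)) ?_
  fun_prop

lemma smoothPosPart_eq_lintegral_gaussianReal (A c : ℝ) :
    smoothPosPart A c =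
      ∫⁻ w, ENNReal.ofReal (max (A + w) 0 ^ 5) ∂gaussianReal 0 (.mk (c ^ 2) (sq_nonneg c)) := by
  have h := gaussianReal_map_const_mul (μ := 0) (v := 1) c
  rw [mul_zero, mul_one] at h
  rw [← h, lintegral_map (by fun_prop) (by fun_prop), smoothPosPart]

/-- Variances of independent normal variables add. -/
lemma lintegral_smoothPosPart (A c c' : ℝ) :
    ∫⁻ y, smoothPosPart (A + c * y) c' ∂gaussianReal 0 1 = smoothPosPart A √(c ^ 2 + c' ^ 2) := by
  have h := gaussianReal_conv_gaussianReal (m₁ := 0) (m₂ := 0)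
    (v₁ := .mk (c ^ 2) (sq_nonneg c)) (v₂ := .mk (c' ^ 2) (sq_nonneg c'))
  have h' := gaussianReal_map_const_mul (μ := 0) (v := 1) c
  rw [mul_zero, mul_one] at h'
  have e : (NNReal.mk (√(c ^ 2 + c' ^ 2) ^ 2) (sq_nonneg _)) =
      .mk (c ^ 2) (sq_nonneg c) + .mk (c' ^ 2) (sq_nonneg c') := by
    ext
    simp only [NNReal.coe_mk, NNReal.coe_add]
    rw [Real.sq_sqrt (by positivity)]
  rw [smoothPosPart_eq_lintegral_gaussianReal A, e]
  rw [add_zero] at h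
  rw [← h, Measure.lintegral_conv (by fun_prop), ← h', lintegral_map ?_ (by fun_prop)]
  · simp_rw [smoothPosPart_eq_lintegral_gaussianReal, add_assoc]
  · refine Measurable.lintegral_prod_right' (f := fun q : ℝ × ℝ =>
      ENNReal.ofReal (max (A + (q.1 + q.2)) 0 ^ 5)) ?_
    fun_prop

lemma max_affine_pow {l : ℝ} (hl : 0 < l) (A x : ℝ) :
    max (A + l * x) 0 ^ 5 = l ^ 5 * max (x - -A / l) 0 ^ 5 := by
  rw [← mul_pow, mul_max_of_nonneg _ _ hl.le, mul_zero]
  congr 2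
  field_simp
  ring

lemma smoothPosPart_eq_gaussianPosPart {c : ℝ} (hc : 0 < c) (A : ℝ) :
    smoothPosPart A c = ENNReal.ofReal (c ^ 5 * gaussianPosPart (-A / c)) := by
  rw [smoothPosPart_eq_ofReal_integral, gaussianPosPart, ← integral_const_mul]
  simp_rw [max_affine_pow hc]

/-- A variable with nonpositive mean, bounded above by `b > 0` and with second moment `v`, is
dominated by the centred normal variable with standard deviation `(b + v / b) / 2`. -/
lemma lintegral_max_affine_le_smoothPosPart {κ : Measure ℝ} [IsProbabilityMeasure κ] {b v : ℝ}
    (hb : 0 < b) (hκb : ∀ᵐ x ∂κ, x ≤ b) (hint : Integrable (fun x => x) κ)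
    (hmean : ∫ x, x ∂κ ≤ 0) (hint2 : Integrable (fun x => x ^ 2) κ) (hv : ∫ x, x ^ 2 ∂κ = v)
    {l : ℝ} (hl : 0 ≤ l) (A : ℝ) :
    ∫⁻ x, ENNReal.ofReal (max (A + l * x) 0 ^ 5) ∂κ ≤
      smoothPosPart A (l * ((b + v / b) / 2)) := by
  rcases hl.eq_or_lt with rfl | hl
  · simp [smoothPosPart_zero_right]
  have hv0 : 0 ≤ v := hv ▸ integral_nonneg fun x => sq_nonneg x
  obtain ⟨a, ha⟩ : ∃ a, a = v / b := ⟨_, rfl⟩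
  have ha0 : 0 ≤ a := ha ▸ div_nonneg hv0 hb.le
  have hab : a * b = v := by rw [ha]; field_simp
  rw [← ha]
  obtain ⟨s, hs⟩ : ∃ s, s = (b + a) / 2 := ⟨_, rfl⟩
  have hs0 : 0 < s := by rw [hs]; linarith
  rw [← hs, smoothPosPart_eq_gaussianPosPart (mul_pos hl hs0)]
  obtain ⟨t, ht⟩ : ∃ t, t = -A / l := ⟨_, rfl⟩
  simp_rw [max_affine_pow hl, ← ht]
  have ht' : -A / (l * s) = t / s := by rw [ht]; field_simp
  rw [ht']
  obtain ⟨α, β, γ, hβ, hγ, hq, he⟩ := exists_quadratic_majorant ha0 hb t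
  have iq : Integrable (fun x => α + β * x + γ * x ^ 2) κ :=
    ((integrable_const _).add (hint.const_mul _)).add (hint2.const_mul _)
  have hle : ∀ᵐ x ∂κ, max (x - t) 0 ^ 5 ≤ α + β * x + γ * x ^ 2 := by
    filter_upwards [hκb] with x hx using hq x hx
  have hval : ∫ x, (α + β * x + γ * x ^ 2) ∂κ ≤ α + γ * (a * b) := by
    have iβ : Integrable (fun x => α + β * x) κ := (integrable_const _).add (hint.const_mul _)
    rw [integral_add iβ (hint2.const_mul _),
      integral_add (integrable_const _) (hint.const_mul _), integral_const_mul,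
      integral_const_mul, hv, hab]
    have := mul_nonneg hβ (neg_nonneg.2 hmean)
    simp
    linarith
  -- `a / (a + b)` is the mass at `b` of the mean-zero law on `{-a, b}`; in units of `s` its atoms
  -- are `2(1 - p)` and `-2p`.
  have htwo := two_point_le_gaussianPosPart (p := a / (a + b)) (by positivity)
    (by rw [div_le_one (by linarith)]; linarith) (t / s)
  have hs1 : 2 * (1 - a / (a + b)) - t / s = (b - t) / s := by
    rw [hs]; field_simp; ring
  have hs2 : -2 * (a / (a + b)) - t / s = (-a - t) / s := by
    rw [hs]; field_simp; ring
  have hm (w : ℝ) : max (w / s) 0 = max w 0 / s := by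
    rw [← max_div_div_right hs0.le, zero_div]
  rw [hs1, hs2, hm, hm, div_pow, div_pow] at htwo
  calc ∫⁻ x, ENNReal.ofReal (l ^ 5 * max (x - t) 0 ^ 5) ∂κ
      ≤ ∫⁻ x, ENNReal.ofReal (l ^ 5 * (α + β * x + γ * x ^ 2)) ∂κ := by
        refine lintegral_mono_ae ?_
        filter_upwards [hle] with x hx
        gcongr
    _ = ENNReal.ofReal (∫ x, l ^ 5 * (α + β * x + γ * x ^ 2) ∂κ) := by
        rw [ofReal_integral_eq_lintegral_ofReal (iq.const_mul _)]
        filter_upwards [hle] with x hx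
        have : 0 ≤ max (x - t) 0 ^ 5 := by positivity
        exact mul_nonneg (by positivity) (this.trans hx)
    _ ≤ _ := by
        refine ENNReal.ofReal_le_ofReal ?_
        rw [integral_const_mul, mul_pow, mul_assoc]
        refine mul_le_mul_of_nonneg_left (hval.trans ?_) (by positivity)
        rw [he]
        refine le_trans (le_of_eq ?_) (mul_le_mul_of_nonneg_left htwo (by positivity : 0 ≤ s ^ 5))
        have := hs0.ne'
        field_simp
        ring

/-! ### Log-concavity of the normal tail and the closed-form bound. -/

/-- Upper tail of the standard normal distribution. -/
noncomputable def gaussianTail (u : ℝ) : ℝ := ∫ y in Set.Ioi u, gaussianPDFReal 0 1 y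

lemma gaussianTail_pos (u : ℝ) : 0 < gaussianTail u := by
  refine (setIntegral_pos_iff_support_of_nonneg_ae (ae_of_all _ (gaussianPDFReal_nonneg 0 1))
    (integrable_gaussianPDFReal 0 1).integrableOn).2 ?_
  have : Function.support (gaussianPDFReal 0 1) = Set.univ :=
    Set.eq_univ_of_forall fun y => (gaussianPDFReal_pos 0 1 y one_ne_zero).ne'
  simp [this]

lemma gaussianReal_Ici (u : ℝ) :
    gaussianReal 0 1 (Set.Ici u) = ENNReal.ofReal (gaussianTail u) := by
  rw [gaussianReal_apply_eq_integral _ one_ne_zero, integral_Ici_eq_integral_Ioi, gaussianTail]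

/-- The hazard rate of the standard normal distribution. -/
noncomputable def gaussianHazard (u : ℝ) : ℝ := gaussianPDFReal 0 1 u / gaussianTail u

lemma gaussianHazard_pos (u : ℝ) : 0 < gaussianHazard u :=
  div_pos (gaussianPDFReal_pos 0 1 u one_ne_zero) (gaussianTail_pos u)

/-- Against an exponential density of rate `h` matched at `x`, the ratio crosses `1` only at `x` and
`2h - x`. -/
lemma gaussianPDFReal_eq_mul_exp (h x y : ℝ) :
    gaussianPDFReal 0 1 y = gaussianPDFReal 0 1 x * Real.exp (-h * (y - x)) *
      Real.exp (-((y - x) * (y - (2 * h - x))) / 2) := by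
  simp only [gaussianPDFReal]
  rw [mul_assoc (√_)⁻¹, ← Real.exp_add, mul_assoc (√_)⁻¹, ← Real.exp_add]
  simp only [NNReal.coe_one, mul_one, sub_zero]
  ring_nf

/-- Log-concavity of the Gaussian tail: it lies below its exponential tangent at `x`. -/
lemma gaussianTail_le (x u : ℝ) :
    gaussianTail u ≤ gaussianTail x * Real.exp (-gaussianHazard x * (u - x)) := by
  set h := gaussianHazard x with hh
  have h0 : 0 < h := gaussianHazard_pos x
  have hQ : gaussianPDFReal 0 1 x = h * gaussianTail x := by
    rw [hh, gaussianHazard, div_mul_cancel₀ _ (gaussianTail_pos x).ne']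
  set g : ℝ → ℝ := fun y => gaussianPDFReal 0 1 x * Real.exp (-h * (y - x)) with hg
  have eg (y : ℝ) : g y = gaussianPDFReal 0 1 x * Real.exp (h * x) * Real.exp (-h * y) := by
    rw [hg, mul_assoc, ← Real.exp_add]
    ring_nf
  have ig (u : ℝ) : IntegrableOn g (Set.Ioi u) := by
    rw [funext eg]
    exact (integrableOn_exp_mul_Ioi (by linarith) u).const_mul _
  have vg (u : ℝ) : ∫ y in Set.Ioi u, g y = gaussianTail x * Real.exp (-h * (u - x)) := by
    simp_rw [eg]
    rw [integral_const_mul, integral_exp_mul_Ioi (by linarith), hQ,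
      show -h * (u - x) = h * x + -h * u by ring, Real.exp_add]
    have := h0.ne'
    field_simp
  have eφ (y : ℝ) := gaussianPDFReal_eq_mul_exp h x y
  have gpos (y : ℝ) : 0 < g y := mul_pos (gaussianPDFReal_pos 0 1 x one_ne_zero) (Real.exp_pos _)
  have dnonneg (y : ℝ) (hy : 0 ≤ (y - x) * (y - (2 * h - x))) : gaussianPDFReal 0 1 y ≤ g y := by
    rw [eφ]
    exact mul_le_of_le_one_right (gpos y).le (Real.exp_le_one_iff.2 (by linarith))
  have dpos (y : ℝ) (hy : 0 < (y - x) * (y - (2 * h - x))) : gaussianPDFReal 0 1 y < g y := by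
    rw [eφ]
    exact mul_lt_of_lt_one_right (gpos y) (Real.exp_lt_one_iff.2 (by linarith))
  have dnonpos (y : ℝ) (hy : (y - x) * (y - (2 * h - x)) ≤ 0) : g y ≤ gaussianPDFReal 0 1 y := by
    rw [eφ]
    exact le_mul_of_one_le_right (gpos y).le (Real.one_le_exp (by linarith))
  -- `d` is nonpositive between `x` and `2h - x`, nonnegative outside, and has integral `0` over
  -- `(x, ∞)`; hence its integral over every `(u, ∞)` is nonnegative.
  set d : ℝ → ℝ := fun y => g y - gaussianPDFReal 0 1 y with hd
  have iφ (u : ℝ) : IntegrableOn (gaussianPDFReal 0 1) (Set.Ioi u) :=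
    (integrable_gaussianPDFReal 0 1).integrableOn
  have id (u : ℝ) : IntegrableOn d (Set.Ioi u) := (ig u).sub (iφ u)
  have vd (u : ℝ) : ∫ y in Set.Ioi u, d y =
      gaussianTail x * Real.exp (-h * (u - x)) - gaussianTail u := by
    rw [hd, integral_sub (ig u) (iφ u), vg, gaussianTail, gaussianTail]
  have vx : ∫ y in Set.Ioi x, d y = 0 := by rw [vd]; simp
  -- Otherwise `d > 0` on all of `(x, ∞)`, contradicting its zero integral.
  have hhx : x ≤ h := by
    by_contra! hlt
    have hpos : ∀ y ∈ Set.Ioi x, 0 < d y := fun y hy => by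
      have hy : x < y := hy
      exact sub_pos.2 (dpos y (mul_pos (by linarith) (by linarith)))
    have := (setIntegral_pos_iff_support_of_nonneg_ae
      ((ae_restrict_iff' measurableSet_Ioi).2 (ae_of_all _ fun y hy => (hpos y hy).le)) (id x)).2
      (by
        have hs : Set.Ioi x ⊆ Function.support d := fun y hy => (hpos y hy).ne'
        rw [Set.inter_eq_right.2 hs]
        simp)
    linarith
  rw [← sub_nonneg, ← vd]
  rcases le_total u x with hux | hux
  · have h1 := intervalIntegral.integral_Ioi_sub_Ioi (id u) hux
    rw [vx, sub_zero] at h1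
    rw [h1]
    refine intervalIntegral.integral_nonneg hux fun y hy => ?_
    exact sub_nonneg.2 (dnonneg y
      (mul_nonneg_of_nonpos_of_nonpos (by linarith [hy.2]) (by linarith [hy.2])))
  rcases le_total u (2 * h - x) with hu | hu
  · have h1 := intervalIntegral.integral_Ioi_sub_Ioi (id x) hux
    rw [vx, zero_sub] at h1
    have h2 : ∫ y in x..u, d y ≤ ∫ y in x..u, (0 : ℝ) := by
      refine intervalIntegral.integral_mono_on hux ?_ (by simp) fun y hy => ?_
      · exact (intervalIntegrable_iff_integrableOn_Ioc_of_le hux).2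
          ((id x).mono_set Set.Ioc_subset_Ioi_self)
      · exact sub_nonpos.2 (dnonpos y
          (mul_nonpos_of_nonneg_of_nonpos (by linarith [hy.1]) (by linarith [hy.2])))
    simp at h2
    linarith
  · refine setIntegral_nonneg measurableSet_Ioi fun y hy => ?_
    have hy : u < y := hy
    exact sub_nonneg.2 (dnonneg y
      (mul_nonneg (by linarith) (by linarith)))

/-- Layer cake: `E[(Z - t)₊⁵] = ∫ 5w⁴ P(Z ≥ t + w) dw`; the exponential tail bound turns it into `5
Γ(5) / h⁵`. -/
lemma gaussianPosPart_le (x t : ℝ) :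
    gaussianPosPart t ≤ gaussianTail x * Real.exp (gaussianHazard x * (x - t)) *
      (Nat.factorial 5 / gaussianHazard x ^ 5) := by
  set h := gaussianHazard x with hh
  have h0 : 0 < h := gaussianHazard_pos x
  have hQ := (gaussianTail_pos x).le
  rw [← ENNReal.ofReal_le_ofReal_iff (by positivity), gaussianPosPart,
    ofReal_integral_eq_lintegral_ofReal (integrable_max_sub_pow_five t)
      (ae_of_all _ fun z => by positivity)]
  have hl := lintegral_rpow_eq_lintegral_meas_le_mul (gaussianReal 0 1)
    (f := fun z => max (z - t) 0) (ae_of_all _ fun z => le_max_right _ _) (by fun_prop)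
    (p := 5) (by norm_num)
  have e5 : ∀ y : ℝ, y ^ (5 : ℝ) = y ^ 5 := fun y => by exact_mod_cast Real.rpow_natCast y 5
  simp_rw [e5] at hl
  refine hl.trans_le ?_
  have hG := Real.integral_rpow_mul_exp_neg_mul_Ioi (a := 5) (r := h) (by norm_num) h0
  have hΓ : Real.Gamma 5 = 24 := by
    have := Real.Gamma_nat_eq_factorial 4
    rw [show ((4 : ℕ) : ℝ) + 1 = 5 by norm_num] at this
    rw [this]
    norm_num [Nat.factorial]
  have hi : IntegrableOn (fun w : ℝ => w ^ (5 - 1 : ℝ) * Real.exp (-(h * w))) (Set.Ioi 0) := by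
    refine Integrable.of_integral_ne_zero ?_
    rw [hG, hΓ]
    positivity
  set C := gaussianTail x * Real.exp (h * (x - t)) with hC
  calc ENNReal.ofReal 5 * ∫⁻ w in Set.Ioi 0, gaussianReal 0 1 {z | w ≤ max (z - t) 0} *
        ENNReal.ofReal (w ^ (5 - 1 : ℝ))
      ≤ ENNReal.ofReal 5 * ∫⁻ w in Set.Ioi 0,
          ENNReal.ofReal (C * (w ^ (5 - 1 : ℝ) * Real.exp (-(h * w)))) := by
        refine mul_le_mul_right (setLIntegral_mono' measurableSet_Ioi fun w hw => ?_) _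
        have hw : 0 < w := hw
        have hs : {z | w ≤ max (z - t) 0} = Set.Ici (t + w) := by
          ext z
          simp only [Set.mem_ofPred_eq, Set.mem_Ici, le_max_iff, not_le.2 hw, or_false]
          constructor <;> intro h <;> linarith
        rw [hs, gaussianReal_Ici, ← ENNReal.ofReal_mul (gaussianTail_pos _).le]
        refine ENNReal.ofReal_le_ofReal ?_
        have h1 := gaussianTail_le x (t + w)
        rw [← hh, show -h * (t + w - x) = h * (x - t) + -(h * w) by ring, Real.exp_add,
          ← mul_assoc] at h1
        have := mul_le_mul_of_nonneg_right h1 (Real.rpow_nonneg hw.le (5 - 1))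
        linarith
    _ = _ := by
        rw [← ofReal_integral_eq_lintegral_ofReal (hi.const_mul C), integral_const_mul, hG, hΓ,
          e5, ← ENNReal.ofReal_mul (by norm_num)]
        · congr 1
          norm_num [Nat.factorial]
          field_simp
          ring
        · refine (ae_restrict_iff' measurableSet_Ioi).2 (ae_of_all _ fun w hw => ?_)
          have hw : 0 < w := hw
          simp only [Pi.zero_apply]
          positivity

lemma bddBelow_range_bentkus (x v : ℝ) : BddBelow (Set.range fun l : ℝ≥0 =>
    ∫ z, (max (1 + (l : ℝ) / 5 * (v * z - x)) 0) ^ 5 ∂(gaussianReal 0 1)) :=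
  ⟨0, by rintro _ ⟨l, rfl⟩; exact integral_nonneg fun z => by positivity⟩

lemma gaussianBentkusBound_le_tail (x : ℝ) {v : ℝ} (hv : 0 < v) :
    gaussianBentkusBound x v ≤
      (Nat.factorial 5 : ℝ) * (Real.exp 1 / 5) ^ 5 * (gaussianReal 0 1).real {z | x ≤ v * z} := by
  obtain ⟨ξ, hξ⟩ : ∃ ξ, ξ = x / v := ⟨_, rfl⟩
  have hx : x = v * ξ := by rw [hξ]; field_simp
  have hs : {z | x ≤ v * z} = Set.Ici ξ := by
    ext z
    rw [Set.mem_ofPred_eq, Set.mem_Ici, hx, mul_le_mul_iff_right₀ hv]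
  rw [hs, measureReal_def, gaussianReal_Ici, ENNReal.toReal_ofReal (gaussianTail_pos ξ).le]
  have h0 := gaussianHazard_pos ξ
  set h := gaussianHazard ξ with hh
  -- `λ = h / v` puts the zero of `1 + (λ/5)(v z - x)` at `ξ - 5/h`, which minimises `(λ v/5)⁵ exp(h
  -- (ξ - t))` and produces `e⁵`.
  refine (ciInf_le (bddBelow_range_bentkus x v) (h / v).toNNReal).trans ?_
  have e (z : ℝ) : max (1 + h / v / 5 * (v * z - x)) 0 ^ 5 =
      (h / 5) ^ 5 * max (z - (ξ - 5 / h)) 0 ^ 5 := by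
    rw [← mul_pow, mul_max_of_nonneg _ _ (by positivity), mul_zero, hx]
    congr 2
    field_simp
    ring
  simp only [Real.coe_toNNReal _ (div_pos h0 hv).le, e]
  rw [integral_const_mul]
  refine (mul_le_mul_of_nonneg_left (gaussianPosPart_le ξ _) (by positivity)).trans (le_of_eq ?_)
  rw [← hh, show h * (ξ - (ξ - 5 / h)) = (5 : ℕ) * 1 by push_cast; field_simp; ring,
    Real.exp_nat_mul]
  field_simp

/-! ### One step of the domination, conditionally on the past. -/

lemma smoothPosPart_le_sqrt (A c d : ℝ) : smoothPosPart A c ≤ smoothPosPart A √(c ^ 2 + d ^ 2) := by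
  rw [← lintegral_smoothPosPart]
  exact lintegral_mono fun y => le_smoothPosPart _ _

/-- One step of the normal domination, for a fixed law. -/
lemma lintegral_smoothPosPart_le {κ : Measure ℝ} [IsProbabilityMeasure κ] {b s : ℝ} {v : ℝ≥0∞}
    (hκb : ∀ᵐ x ∂κ, x ≤ b) (hint : Integrable (fun x => x) κ) (hmean : ∫ x, x ∂κ ≤ 0)
    (hv : ∫⁻ x, ENNReal.ofReal (x ^ 2) ∂κ = v)
    (hs : 0 < b → v ≠ ∞ ∧ s = (b + v.toReal / b) / 2) {l : ℝ} (hl : 0 ≤ l) (A c : ℝ) :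
    ∫⁻ x, smoothPosPart (A + l * x) c ∂κ ≤ smoothPosPart A √(c ^ 2 + (l * s) ^ 2) := by
  -- For `b ≤ 0` the value of `s` is irrelevant, so the convention at `b = 0` plays no role.
  rcases le_or_gt b 0 with hb | hb
  · calc ∫⁻ x, smoothPosPart (A + l * x) c ∂κ ≤ ∫⁻ x, smoothPosPart A c ∂κ := by
          refine lintegral_mono_ae ?_
          filter_upwards [hκb] with x hx
          exact smoothPosPart_mono_left (by nlinarith) c
      _ = smoothPosPart A c := by simp
      _ ≤ _ := smoothPosPart_le_sqrt A c (l * s)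
  obtain ⟨hfin, rfl⟩ := hs hb
  have hint2 : Integrable (fun x : ℝ => x ^ 2) κ := by
    refine ⟨by fun_prop, ?_⟩
    rw [hasFiniteIntegral_iff_ofReal (ae_of_all _ fun x => sq_nonneg x), hv]
    exact hfin.lt_top
  have hv' : ∫ x, x ^ 2 ∂κ = v.toReal := by
    rw [← hv, integral_eq_lintegral_of_nonneg_ae (ae_of_all _ fun x => sq_nonneg x) (by fun_prop)]
  rw [← lintegral_smoothPosPart]
  unfold smoothPosPart
  rw [lintegral_lintegral_swap (by fun_prop)]
  refine lintegral_mono fun z => ?_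
  have h := lintegral_max_affine_le_smoothPosPart hb hκb hint hmean hint2 hv' hl (A + c * z)
  simp_rw [add_right_comm A _ (c * z)]
  exact h

lemma lintegral_comp_condDistrib {Ω β : Type*} {m : MeasurableSpace Ω} {mβ : MeasurableSpace β}
    {μ : Measure Ω} [IsFiniteMeasure μ] {T : Ω → β} (hT : Measurable T) {Y : Ω → ℝ}
    (hY : Measurable Y) {H : β → ℝ → ℝ≥0∞} (hH : Measurable (Function.uncurry H)) :
    ∫⁻ ω, H (T ω) (Y ω) ∂μ = ∫⁻ ω, ∫⁻ y, H (T ω) y ∂condDistrib Y T μ (T ω) ∂μ := by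
  have h := compProd_map_condDistrib (mβ := mβ) (μ := μ) (X := T) (Y := Y) hY.aemeasurable
  calc ∫⁻ ω, H (T ω) (Y ω) ∂μ
      = ∫⁻ p, Function.uncurry H p ∂(μ.map fun ω => (T ω, Y ω)) := by
        rw [lintegral_map hH (hT.prodMk hY)]; rfl
    _ = ∫⁻ t, ∫⁻ y, H t y ∂condDistrib Y T μ t ∂(μ.map T) := by
        rw [← h, Measure.lintegral_compProd hH]; rfl
    _ = _ := lintegral_map hH.lintegral_kernel_prod_right hT

lemma lintegral_sq_condDistrib {Ω β : Type*} {m : MeasurableSpace Ω} {mβ : MeasurableSpace β}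
    {μ : Measure Ω} [IsFiniteMeasure μ] {T : Ω → β} (hT : Measurable T) {Y : Ω → ℝ}
    (hY : Measurable Y) :
    ∀ᵐ ω ∂μ, ∫⁻ y, ENNReal.ofReal (y ^ 2) ∂condDistrib Y T μ (T ω) =
      condLExp (mβ.comap T) μ (fun ω => ENNReal.ofReal (Y ω ^ 2)) ω := by
  have hmeas : Measurable fun t => ∫⁻ y, ENNReal.ofReal (y ^ 2) ∂condDistrib Y T μ t :=
    Measurable.lintegral_kernel (by fun_prop)
  refine ae_eq_condLExp hT.comap_le μ _ (hmeas.comp (comap_measurable T)) ?_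
  rintro _ ⟨S, hS, rfl⟩
  have h1 := lintegral_comp_condDistrib (μ := μ) hT hY
    (H := fun t y => S.indicator 1 t * ENNReal.ofReal (y ^ 2))
    (((measurable_one.indicator hS).comp measurable_fst).mul (by fun_prop))
  rw [← lintegral_indicator (hT hS), ← lintegral_indicator (hT hS)]
  refine (lintegral_congr fun ω => ?_).trans (h1.symm.trans (lintegral_congr fun ω => ?_))
  · by_cases h : T ω ∈ S <;> simp [h]
  · by_cases h : T ω ∈ S <;> simp [h]

lemma measurable_smoothPosPart_comp {β : Type*} {mβ : MeasurableSpace β} {f g : β → ℝ}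
    (hf : Measurable f) (hg : Measurable g) : Measurable fun t => smoothPosPart (f t) (g t) := by
  have h := measurable_smoothPosPart
  generalize smoothPosPart = s at *
  exact h.comp (hf.prodMk hg)

/-- One step of the normal domination, conditionally on `T`. -/
lemma setLIntegral_smoothPosPart_le {Ω β : Type*} {m : MeasurableSpace Ω} {mβ : MeasurableSpace β}
    {μ : Measure Ω} [IsProbabilityMeasure μ] {T : Ω → β} (hT : Measurable T) {Y : Ω → ℝ}
    (hY : Measurable Y) (hYint : Integrable Y μ) (hYmean : μ[Y | mβ.comap T] ≤ᵐ[μ] 0)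
    {b : β → ℝ} (hb : Measurable b) (hYb : ∀ᵐ ω ∂μ, Y ω ≤ b (T ω)) {v : Ω → ℝ≥0∞}
    (hv : v = condLExp (mβ.comap T) μ fun ω => ENNReal.ofReal (Y ω ^ 2))
    {D : Set β} (hD : MeasurableSet D) {s : Ω → ℝ}
    (hs : ∀ ω, T ω ∈ D → 0 < b (T ω) →
      v ω ≠ ∞ ∧ s ω = (b (T ω) + (v ω).toReal / b (T ω)) / 2)
    {l : ℝ} (hl : 0 ≤ l) {A c : β → ℝ} (hA : Measurable A) (hc : Measurable c) :
    ∫⁻ ω in T ⁻¹' D, smoothPosPart (A (T ω) + l * Y ω) (c (T ω)) ∂μ ≤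
      ∫⁻ ω in T ⁻¹' D, smoothPosPart (A (T ω)) √(c (T ω) ^ 2 + (l * s ω) ^ 2) ∂μ := by
  set κ := condDistrib Y T μ with hκ
  have f1 : ∀ᵐ ω ∂μ, ∀ᵐ y ∂κ (T ω), y ≤ b (T ω) := by
    have h1 : ∀ᵐ p ∂(μ.map fun ω => (T ω, Y ω)), p.2 ≤ b p.1 := by
      exact (ae_map_iff (hT.prodMk hY).aemeasurable
        (measurableSet_le measurable_snd (hb.comp measurable_fst))).2 hYb
    rw [← compProd_map_condDistrib hY.aemeasurable] at h1
    exact ae_of_ae_map hT.aemeasurable (Measure.ae_ae_of_ae_compProd h1)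
  have f2 : ∀ᵐ ω ∂μ, Integrable (fun y => y) (κ (T ω)) := by
    have h1 : Integrable (fun p : β × ℝ => p.2) (μ.map fun ω => (T ω, Y ω)) :=
      (integrable_map_measure (by fun_prop) (hT.prodMk hY).aemeasurable).2 hYint
    exact h1.condDistrib_ae hT.aemeasurable hY.aemeasurable
  have f3 : ∀ᵐ ω ∂μ, ∫ y, y ∂κ (T ω) ≤ 0 := by
    filter_upwards [hYmean, condExp_ae_eq_integral_condDistrib' hT hYint] with ω h1 h2
    rw [← h2]
    exact h1
  have f4 := lintegral_sq_condDistrib (μ := μ) hT hY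
  rw [← hv] at f4
  have m1 : Measurable fun p : β × ℝ => A p.1 + l * p.2 := by fun_prop
  have m0 : Measurable fun p : β × ℝ => c p.1 := by fun_prop
  have m2 : Measurable fun p : β × ℝ => smoothPosPart (A p.1 + l * p.2) (c p.1) :=
    measurable_smoothPosPart_comp m1 m0
  have m3 : Measurable fun p : β × ℝ => D.indicator (1 : β → ℝ≥0∞) p.1 :=
    (measurable_one.indicator hD).comp measurable_fst
  have hH : Measurable (Function.uncurry fun t y =>
      D.indicator 1 t * smoothPosPart (A t + l * y) (c t)) := m3.mul m2
  have h1 := lintegral_comp_condDistrib (μ := μ) hT hY hH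
  rw [← lintegral_indicator (hT hD), ← lintegral_indicator (hT hD)]
  calc ∫⁻ ω, (T ⁻¹' D).indicator (fun ω => smoothPosPart (A (T ω) + l * Y ω) (c (T ω))) ω ∂μ
      = ∫⁻ ω, D.indicator 1 (T ω) * smoothPosPart (A (T ω) + l * Y ω) (c (T ω)) ∂μ := by
        refine lintegral_congr fun ω => ?_
        by_cases h : T ω ∈ D <;> simp [h]
    _ = ∫⁻ ω, ∫⁻ y, D.indicator 1 (T ω) * smoothPosPart (A (T ω) + l * y) (c (T ω))
          ∂κ (T ω) ∂μ := h1
    _ ≤ _ := by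
        refine lintegral_mono_ae ?_
        filter_upwards [f1, f2, f3, f4] with ω g1 g2 g3 g4
        by_cases h : T ω ∈ D
        · have g5 := lintegral_smoothPosPart_le g1 g2 g3 g4 (hs ω h) hl (A (T ω)) (c (T ω))
          rw [Set.indicator_of_mem h, Set.indicator_of_mem (by exact h)]
          simpa only [Pi.one_apply, one_mul] using g5
        · rw [Set.indicator_of_notMem h]
          simp

/-! ### A maximal inequality. -/

/-- Ville's inequality for nonnegative processes with decreasing integrals. -/
lemma measure_iUnion_le_lintegral {Ω : Type*} {m : MeasurableSpace Ω} {μ : Measure Ω}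
    {ℱ : Filtration ℕ m} {M : ℕ → Ω → ℝ≥0∞} {E : ℕ → Set Ω}
    (hE : ∀ k, MeasurableSet[ℱ k] (E k)) (hM : ∀ k, ∀ ω ∈ E k, 1 ≤ M k ω)
    (hsup : ∀ k A, MeasurableSet[ℱ k] A → ∫⁻ ω in A, M (k + 1) ω ∂μ ≤ ∫⁻ ω in A, M k ω ∂μ) :
    μ (⋃ k, E k) ≤ ∫⁻ ω, M 0 ω ∂μ := by
  have hU : ∀ n, MeasurableSet[ℱ n] (Set.accumulate E n) := fun n => by
    rw [Set.accumulate_def]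
    exact MeasurableSet.biUnion (Set.to_countable _) fun k hk => ℱ.mono hk _ (hE k)
  have hone : ∀ n S, MeasurableSet S → S ⊆ E n → μ S ≤ ∫⁻ ω in S, M n ω ∂μ := fun n S hS hSE => by
    rw [← setLIntegral_one]
    exact setLIntegral_mono' hS fun ω hω => hM n ω (hSE hω)
  -- Mass already absorbed by the events, plus the integral of `M n` where none has occurred yet.
  have key : ∀ n, μ (Set.accumulate E n) + ∫⁻ ω in (Set.accumulate E n)ᶜ, M n ω ∂μ ≤
      ∫⁻ ω, M 0 ω ∂μ := by
    intro n
    induction n with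
    | zero =>
      have h0 : MeasurableSet (E 0) := ℱ.le 0 _ (hE 0)
      rw [Set.accumulate_zero_nat]
      exact (add_le_add (hone 0 _ h0 subset_rfl) le_rfl).trans_eq (lintegral_add_compl (M 0) h0)
    | succ n ih =>
      refine le_trans ?_ ih
      have hn : MeasurableSet (Set.accumulate E n) := ℱ.le n _ (hU n)
      have hn1 : MeasurableSet (E (n + 1)) := ℱ.le _ _ (hE (n + 1))
      have h1 := hsup n _ (hU n).compl
      have e1 : Set.accumulate E (n + 1) =
          Set.accumulate E n ∪ (E (n + 1) ∩ (Set.accumulate E n)ᶜ) := by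
        rw [Set.accumulate_succ, Set.union_inter_distrib_left, Set.union_compl_self, Set.inter_univ]
      have e2 : (Set.accumulate E (n + 1))ᶜ = (E (n + 1))ᶜ ∩ (Set.accumulate E n)ᶜ := by
        rw [Set.accumulate_succ, Set.compl_union, Set.inter_comm]
      calc μ (Set.accumulate E (n + 1)) + ∫⁻ ω in (Set.accumulate E (n + 1))ᶜ, M (n + 1) ω ∂μ
          ≤ (μ (Set.accumulate E n) +
              ∫⁻ ω in E (n + 1) ∩ (Set.accumulate E n)ᶜ, M (n + 1) ω ∂μ) +
              ∫⁻ ω in (E (n + 1))ᶜ ∩ (Set.accumulate E n)ᶜ, M (n + 1) ω ∂μ := by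
            rw [e2, e1]
            exact add_le_add ((measure_union_le _ _).trans (add_le_add le_rfl
              (hone (n + 1) _ (hn1.inter hn.compl) Set.inter_subset_left))) le_rfl
        _ = μ (Set.accumulate E n) + ∫⁻ ω in (Set.accumulate E n)ᶜ, M (n + 1) ω ∂μ := by
            rw [add_assoc, ← lintegral_add_compl (μ := μ.restrict (Set.accumulate E n)ᶜ) _ hn1,
              Measure.restrict_restrict hn1, Measure.restrict_restrict hn1.compl]
        _ ≤ _ := by gcongr
  rw [measure_iUnion_eq_iSup_accumulate]
  exact iSup_le fun n => le_self_add.trans (key n)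

/-! ### Extended-real scales. -/

lemma EReal.sq_nonneg' (a : EReal) : 0 ≤ a ^ 2 := by
  rw [sq]
  induction a with
  | bot => simp
  | top => simp
  | coe r => exact_mod_cast mul_self_nonneg r

lemma EReal.ne_top_of_sq_ne_top {a : EReal} (h : a ^ 2 ≠ ⊤) : a ≠ ⊤ ∧ a ≠ ⊥ := by
  rw [sq] at h
  constructor <;> rintro rfl <;> simp at h

/-- Where `V k² ≤ v²` and `B > 0`, the conditional second moment is therefore finite and the scale
is the real number of the one-step lemma. -/
lemma EReal.scale_of_pos {b : ℝ} (hb : 0 < b) {v : ℝ≥0∞}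
    (h : ((b : EReal) + (v : EReal) / (b : EReal)) / 2 ≠ ⊤) :
    v ≠ ∞ ∧ (((b : EReal) + (v : EReal) / (b : EReal)) / 2).toReal = (b + v.toReal / b) / 2 := by
  have hv : v ≠ ∞ := by
    rintro rfl
    apply h
    rw [EReal.coe_ennreal_top,
      EReal.top_div_of_pos_ne_top (by exact_mod_cast hb) (EReal.coe_ne_top b),
      EReal.coe_add_top, EReal.top_div_of_pos_ne_top (by norm_num) (by exact EReal.coe_ne_top 2)]
  refine ⟨hv, ?_⟩
  lift v to ℝ≥0 using hv
  have e : ((b : EReal) + (((v : ℝ≥0) : ℝ≥0∞) : EReal) / (b : EReal)) / 2 =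
      (((b + (v : ℝ) / b) / 2 : ℝ) : EReal) := by
    rw [EReal.coe_div, EReal.coe_add, EReal.coe_div]
    rfl
  rw [e, EReal.toReal_coe]
  rfl

/-! ### The dominating supermartingale. -/

section Supermartingale

variable {Ω : Type*} {m : MeasurableSpace Ω} {μ : Measure Ω} {ℱ : Filtration ℕ m} {X B : ℕ → Ω → ℝ}

lemma measurable_condScale {i : ℕ} (hB : Measurable[ℱ (i - 1)] (B i)) :
    Measurable[ℱ (i - 1)] (condScale X B ℱ μ i) := by
  unfold condScale condSecondMoment
  have h1 : Measurable[ℱ (i - 1)]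
      (condLExp (ℱ (i - 1)) μ fun ω => ENNReal.ofReal (X i ω ^ 2)) := measurable_condLExp _ _ _
  simp only [div_eq_mul_inv, ← EReal.coe_inv]
  exact (hB.coe_real_ereal.add (h1.coe_ereal_ennreal.mul hB.inv.coe_real_ereal)).mul_const _

lemma measurable_cumScaleSq {k : ℕ} (hB : ∀ i, 1 ≤ i → Measurable[ℱ (i - 1)] (B i)) :
    Measurable[ℱ (k - 1)] (cumScaleSq X B ℱ μ k) := by
  unfold cumScaleSq
  refine Finset.measurable_fun_sum _ fun i hi => ?_
  have hi' := Finset.mem_Icc.1 hi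
  exact ((measurable_condScale (hB i hi'.1)).mono (ℱ.mono (by omega)) le_rfl).pow_const 2

lemma cumScaleSq_succ (k : ℕ) (ω : Ω) :
    cumScaleSq X B ℱ μ (k + 1) ω =
      cumScaleSq X B ℱ μ k ω + condScale X B ℱ μ (k + 1) ω ^ 2 := by
  rw [cumScaleSq, Finset.sum_Icc_succ_top (by omega), cumScaleSq]

lemma cumScaleSq_nonneg (k : ℕ) (ω : Ω) : 0 ≤ cumScaleSq X B ℱ μ k ω :=
  Finset.sum_nonneg fun _ _ => EReal.sq_nonneg' _

lemma cumScaleSq_succ_le {k : ℕ} {ω : Ω} {r : ℝ}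
    (h : cumScaleSq X B ℱ μ (k + 1) ω ≤ (r : EReal)) :
    cumScaleSq X B ℱ μ k ω ≤ (r : EReal) ∧ condScale X B ℱ μ (k + 1) ω ≠ ⊤ ∧
      (cumScaleSq X B ℱ μ (k + 1) ω).toReal =
        (cumScaleSq X B ℱ μ k ω).toReal + (condScale X B ℱ μ (k + 1) ω).toReal ^ 2 ∧
      (cumScaleSq X B ℱ μ (k + 1) ω).toReal ≤ r := by
  have h0 := h
  rw [cumScaleSq_succ] at h
  have hV := cumScaleSq_nonneg (X := X) (B := B) (ℱ := ℱ) (μ := μ) k ω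
  have hS := EReal.sq_nonneg' (condScale X B ℱ μ (k + 1) ω)
  have h1 : cumScaleSq X B ℱ μ k ω ≤ r := (le_add_of_nonneg_right hS).trans h
  have h2 : condScale X B ℱ μ (k + 1) ω ^ 2 ≤ r := (le_add_of_nonneg_left hV).trans h
  have h3 := EReal.ne_top_of_sq_ne_top (h2.trans_lt (EReal.coe_lt_top r)).ne
  have e : cumScaleSq X B ℱ μ (k + 1) ω = (((cumScaleSq X B ℱ μ k ω).toReal +
      (condScale X B ℱ μ (k + 1) ω).toReal ^ 2 : ℝ) : EReal) := by
    rw [cumScaleSq_succ, EReal.coe_add, EReal.coe_pow,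
      EReal.coe_toReal (h1.trans_lt (EReal.coe_lt_top r)).ne
        (EReal.bot_lt_zero.trans_le hV).ne', EReal.coe_toReal h3.1 h3.2]
  refine ⟨h1, h3.1, by rw [e, EReal.toReal_coe], ?_⟩
  rw [e] at h0 ⊢
  exact_mod_cast h0

/-- The normal-domination supermartingale: the conditional expectation of `(1 + l (Sₖ + W - x))₊⁵`
with `W` normal of variance `v² - Vₖ²`, killed when `Vₖ²` exceeds `v²`. -/
noncomputable def dominatingProcess (X B : ℕ → Ω → ℝ) (ℱ : Filtration ℕ m) (μ : Measure Ω)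
    (x v l : ℝ) (k : ℕ) : Ω → ℝ≥0∞ :=
  {ω | cumScaleSq X B ℱ μ k ω ≤ ((v ^ 2 : ℝ) : EReal)}.indicator fun ω =>
    smoothPosPart (1 + l * (∑ i ∈ Finset.Icc 1 k, X i ω - x))
      (l * √(v ^ 2 - (cumScaleSq X B ℱ μ k ω).toReal))

lemma measurableSet_cumScaleSq_le {k : ℕ} (hB : ∀ i, 1 ≤ i → Measurable[ℱ (i - 1)] (B i)) (r : ℝ) :
    MeasurableSet[ℱ (k - 1)] {ω | cumScaleSq X B ℱ μ k ω ≤ (r : EReal)} :=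
  measurable_cumScaleSq hB measurableSet_Iic

lemma measurable_partialSum (hX : StronglyAdapted ℱ X) (k : ℕ) :
    Measurable[ℱ k] fun ω => ∑ i ∈ Finset.Icc 1 k, X i ω :=
  Finset.measurable_fun_sum _ fun i hi =>
    (hX i).measurable.mono (ℱ.mono (Finset.mem_Icc.1 hi).2) le_rfl

lemma measurableSet_crossingEvent (hX : StronglyAdapted ℱ X)
    (hB : ∀ i, 1 ≤ i → Measurable[ℱ (i - 1)] (B i)) (x v : ℝ) (k : ℕ) :
    MeasurableSet[ℱ k] (crossingEvent X B ℱ μ x v k) :=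
  @MeasurableSet.inter _ (ℱ k) _ _ (measurable_partialSum hX k measurableSet_Ici)
    (ℱ.mono (by omega) _ (measurableSet_cumScaleSq_le hB _))

lemma one_le_dominatingProcess {x v l : ℝ} (hl : 0 ≤ l) {k : ℕ} {ω : Ω}
    (hω : ω ∈ crossingEvent X B ℱ μ x v k) : 1 ≤ dominatingProcess X B ℱ μ x v l k ω := by
  rw [dominatingProcess, Set.indicator_of_mem (by exact hω.2)]
  refine le_trans ?_ (le_smoothPosPart _ _)
  rw [ENNReal.one_le_ofReal]
  refine one_le_pow₀ (le_max_of_le_left ?_)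
  have := mul_nonneg hl (sub_nonneg.2 hω.1)
  linarith

lemma setLIntegral_dominatingProcess_le [IsProbabilityMeasure μ] (hX : IsSupermartingaleDiff X ℱ μ)
    (hB : ∀ i, 1 ≤ i → Measurable[ℱ (i - 1)] (B i))
    (hXB : ∀ i, 1 ≤ i → ∀ᵐ ω ∂μ, X i ω ≤ B i ω) {x v l : ℝ} (hl : 0 ≤ l) (k : ℕ) {S : Set Ω}
    (hS : MeasurableSet[ℱ k] S) :
    ∫⁻ ω in S, dominatingProcess X B ℱ μ x v l (k + 1) ω ∂μ ≤
      ∫⁻ ω in S, dominatingProcess X B ℱ μ x v l k ω ∂μ := by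
  obtain ⟨hXa, hXi, hXm⟩ := hX
  have hD1 : MeasurableSet[ℱ k] {ω | cumScaleSq X B ℱ μ (k + 1) ω ≤ ((v ^ 2 : ℝ) : EReal)} :=
    measurableSet_cumScaleSq_le (k := k + 1) hB _
  have hD0 : MeasurableSet[ℱ k] {ω | cumScaleSq X B ℱ μ k ω ≤ ((v ^ 2 : ℝ) : EReal)} :=
    ℱ.mono (by omega) _ (measurableSet_cumScaleSq_le hB _)
  set D1 := {ω | cumScaleSq X B ℱ μ (k + 1) ω ≤ ((v ^ 2 : ℝ) : EReal)} with hD1e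
  set D0 := {ω | cumScaleSq X B ℱ μ k ω ≤ ((v ^ 2 : ℝ) : EReal)} with hD0e
  have hsub : D1 ⊆ D0 := fun ω hω => (cumScaleSq_succ_le hω).1
  have hcomap : (ℱ k).comap (id : Ω → Ω) = ℱ k := MeasurableSpace.comap_id
  have hV : Measurable[ℱ k] (cumScaleSq X B ℱ μ (k + 1)) := measurable_cumScaleSq (k := k + 1) hB
  -- Conditioning on `ℱ k` is conditioning on the identity map into `(Ω, ℱ k)`. The set `D1` is `ℱ
  -- k`-measurable because `V (k+1)²` is predictable.
  have hstep := @setLIntegral_smoothPosPart_le Ω Ω m (ℱ k) μ _ id (measurable_id'' (ℱ.le k))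
    (X (k + 1)) ((hXa (k + 1)).measurable.mono (ℱ.le _) le_rfl) (hXi (k + 1))
    (by rw [hcomap]; exact hXm (k + 1) (by omega)) (B (k + 1)) (hB (k + 1) (by omega))
    (hXB (k + 1) (by omega)) (condSecondMoment X ℱ μ (k + 1)) (by rw [hcomap]; rfl)
    (S ∩ D1) (@MeasurableSet.inter _ (ℱ k) _ _ hS hD1)
    (fun ω => (condScale X B ℱ μ (k + 1) ω).toReal)
    (fun ω hω hb => EReal.scale_of_pos hb (cumScaleSq_succ_le hω.2).2.1) l hl
    (fun ω => 1 + l * (∑ i ∈ Finset.Icc 1 k, X i ω - x))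
    (fun ω => l * √(v ^ 2 - (cumScaleSq X B ℱ μ (k + 1) ω).toReal))
    ((((measurable_partialSum hXa k).sub_const x).const_mul l).const_add 1)
    (((hV.ereal_toReal.const_sub (v ^ 2)).sqrt).const_mul l)
  rw [Set.preimage_id] at hstep
  have mS : MeasurableSet S := ℱ.le k _ hS
  have mD1 : MeasurableSet D1 := ℱ.le k _ hD1
  have mD0 : MeasurableSet D0 := ℱ.le k _ hD0
  unfold dominatingProcess
  rw [← hD0e, ← hD1e, setLIntegral_indicator mD1, setLIntegral_indicator mD0,
    Set.inter_comm, Set.inter_comm D0]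
  calc _ = ∫⁻ ω in S ∩ D1, smoothPosPart (1 + l * (∑ i ∈ Finset.Icc 1 k, X i (id ω) - x) +
          l * X (k + 1) ω) (l * √(v ^ 2 - (cumScaleSq X B ℱ μ (k + 1) (id ω)).toReal)) ∂μ := by
        refine lintegral_congr fun ω => ?_
        rw [Finset.sum_Icc_succ_top (by omega)]
        congr 1
        simp only [id]
        ring
    _ ≤ _ := hstep
    _ = ∫⁻ ω in S ∩ D1, smoothPosPart (1 + l * (∑ i ∈ Finset.Icc 1 k, X i ω - x))
          (l * √(v ^ 2 - (cumScaleSq X B ℱ μ k ω).toReal)) ∂μ := by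
        refine setLIntegral_congr_fun (mS.inter mD1) fun ω hω => ?_
        obtain ⟨-, -, h1, h2⟩ := cumScaleSq_succ_le hω.2
        simp only [id]
        -- The variances recombine: `(v² - V (k+1)²) + s (k+1)² = v² - V k²`.
        rw [mul_pow, mul_pow, ← mul_add, Real.sq_sqrt (by linarith), Real.sqrt_mul (sq_nonneg l),
          Real.sqrt_sq hl, h1]
        ring_nf
    _ ≤ _ := lintegral_mono_set (Set.inter_subset_inter_right _ hsub)

/-- Ville's inequality treats all times at once, so finite and infinite horizons both follow by
inclusion; adding `k = 0` costs nothing because `M 0` is the bound itself. -/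
lemma measureReal_iUnion_crossingEvent_le [IsProbabilityMeasure μ]
    (hX : IsSupermartingaleDiff X ℱ μ) (hB : ∀ i, 1 ≤ i → Measurable[ℱ (i - 1)] (B i))
    (hXB : ∀ i, 1 ≤ i → ∀ᵐ ω ∂μ, X i ω ≤ B i ω) (x : ℝ) {v : ℝ} (hv : 0 < v) :
    μ.real (⋃ k, crossingEvent X B ℱ μ x v k) ≤ gaussianBentkusBound x v := by
  refine le_ciInf fun l => ?_
  have hl : 0 ≤ (l : ℝ) / 5 := by positivity
  have h := measure_iUnion_le_lintegral (μ := μ) (ℱ := ℱ)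
    (M := dominatingProcess X B ℱ μ x v (l / 5)) (E := crossingEvent X B ℱ μ x v)
    (measurableSet_crossingEvent hX.1 hB x v) (fun k ω hω => one_le_dominatingProcess hl hω)
    (fun k A hA => setLIntegral_dominatingProcess_le hX hB hXB hl k hA)
  have h0 : dominatingProcess X B ℱ μ x v (l / 5) 0 =
      fun _ => smoothPosPart (1 + l / 5 * (-x)) (l / 5 * v) := by
    funext ω
    have hv2 : (0 : EReal) ≤ ((v ^ 2 : ℝ) : EReal) := by exact_mod_cast sq_nonneg v
    rw [dominatingProcess, Set.indicator_of_mem (by simpa [cumScaleSq] using hv2)]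
    simp [cumScaleSq, Real.sqrt_sq hv.le]
  rw [h0, lintegral_const, measure_univ, mul_one, smoothPosPart_eq_ofReal_integral] at h
  have e (z : ℝ) : 1 + (l : ℝ) / 5 * -x + l / 5 * v * z = 1 + l / 5 * (v * z - x) := by ring
  simp_rw [e] at h
  exact ENNReal.toReal_le_of_le_ofReal (integral_nonneg fun z => by positivity) h

end Supermartingale

theorem mainTheorem2 {Ω : Type*} {m : MeasurableSpace Ω} (μ : Measure Ω) [IsProbabilityMeasure μ]
    (ℱ : Filtration ℕ m) (X B : ℕ → Ω → ℝ)
    (hX : IsSupermartingaleDiff X ℱ μ)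
    (hB : ∀ i, 1 ≤ i → Measurable[ℱ (i - 1)] (B i))
    (hXB : ∀ i, 1 ≤ i → ∀ᵐ ω ∂μ, X i ω ≤ B i ω)
    (x v : ℝ) (hx : 0 ≤ x) (hv : 0 < v) :
    (∀ n : ℕ, 1 ≤ n →
      μ.real (⋃ k ∈ Finset.Icc 1 n, crossingEvent X B ℱ μ x v k) ≤ gaussianBentkusBound x v) ∧
    gaussianBentkusBound x v ≤
      (Nat.factorial 5 : ℝ) * (Real.exp 1 / 5) ^ 5 * (gaussianReal 0 1).real {z | x ≤ v * z} ∧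
    μ.real (⋃ k ∈ Set.Ici 1, crossingEvent X B ℱ μ x v k) ≤ gaussianBentkusBound x v := by
  have h := measureReal_iUnion_crossingEvent_le hX hB hXB x hv
  refine ⟨fun n _ => ?_, gaussianBentkusBound_le_tail x hv, ?_⟩
  · exact (measureReal_mono (Set.iUnion₂_subset_iUnion _ _)).trans h
  · exact (measureReal_mono (Set.iUnion₂_subset_iUnion _ _)).trans h
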